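/- **Setting.** Let $G=(V,E)$ be any undirected graph on $V=\{1,\dots,N\}$, let $\mathcal N_i=\{i\}\cup\{j:(i,j)\in E\}$, $N_i=|\mathcal N_i|$, $N_{\max}=\max_i N_i$, and let $\alpha(G)$ be the independence number of $G$. Let $\mathcal X$ be the closed Euclidean unit ball of $\mathbb R^d$ and let $\ell_1,\ell_2,\dots:\mathcal X\to\mathbb R$ be convex losses, fixed in advance. Let $q\in[0,1]^N$ with $\sum_i q_i=1$ and $Q_j=\sum_{i\in\mathcal N_j}q_i$; the activations $i_1,\dots,i_T$ are independent with $\mathbb P(i_t=i)=q_i$. Let $w_{ij}\ge 0$ ($j\in\mathcal N_i$) be weights with $\sum_{j\in\mathcal N_i}w_{ij}=1$ for every $i$. For $U\in\mathcal X^N$ (rows $U_1,\dots,U_N\in\mathcal X$) let $\sigma_j^2=\frac{1}{2N_j(N_j-1)}\sum_{i,i'\in\mathcal N_j}\|U_i-U_{i'}\|_2^2$ and $\sigma^2_{\max}=\max_j\sigma_j^2$. Divisions by $0$ have value $0$. **MT-COOL with MT-FTRL.** Put $n_j(t)=\sum_{s\le t}\mathbb 1\{i_s\in\mathcal N_j\}$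 and $\beta^{(j)}_{t-1}=\sqrt{\sum_{i\in\mathcal N_j}\frac{q_i}{Q_j}w_{ij}^2}\,\sqrt{1+n_j(t-1)}$. For $X\in\mathcal X^{\mathcal N_j}$ let $\sigma^2(X)=\frac1{N_j-1}\sum_{i\in\mathcal N_j}\big\|X_i-\frac1{N_j}\sum_{k\in\mathcal N_j}X_k\big\|_2^2$ and $\|X\|_{A_j}^2=\operatorname{tr}(X^\top A_jX)$ with $A_j=(1+N_j)I-\mathbf 1\mathbf 1^\top$. Write $L^{(j)}_s(X)=\langle w_{i_sj}g_s,X_{i_s}\rangle$ if $i_s\in\mathcal N_j$, and $L_s^{(j)}(X)=0$ otherwise. For each $\xi\in\Xi_j=\{1/N_j,2/N_j,\dots,1\}$ let $$X_t^{(j,\xi)}=\operatorname*{argmin}_{X\in\mathcal X^{\mathcal N_j},\ \sigma^2(X)\le\xi}\ \frac{N_j\sqrt{1+\xi(N_j-1)}}{\beta^{(j)}_{t-1}}\sum_{s\le t-1}L^{(j)}_s(X)+\tfrac12\|X\|_{A_j}^2,\qquad p_t^{(j,\xi)}\propto\exp\Big(-\tfrac{\sqrt{\ln N_j}}{\beta^{(j)}_{t-1}}\sum_{s\le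 t-1}L^{(j)}_s\big(X_s^{(j,\xi)}\big)\Big),$$ where $p_t^{(j,\cdot)}$ is normalized to sum to $1$ over $\Xi_j$, and let $Y_t^{(j)}=\sum_{\xi\in\Xi_j}p_t^{(j,\xi)}X_t^{(j,\xi)}$. In round $t$ the active agent $i_t$ predicts $x_t=\sum_{j\in\mathcal N_{i_t}}w_{i_tj}[Y_t^{(j)}]_{i_t}$ and observes a subgradient $g_t\in\partial\ell_t(x_t)$ (that is, $\ell_t(y)\ge\ell_t(x_t)+\langle g_t,y-x_t\rangle$ for all $y\in\mathcal X$) with $\|g_t\|_2\le1$, which may depend on $i_1,\dots,i_t$. The regret is $R_T(U)=\sum_{t=1}^T\big(\ell_t(x_t)-\ell_t(U_{i_t})\big)$. **Theorem.** There is a universal constant $C>0$ such that in this setting, for all $N,d,T,G,q,w$, all losses and subgradient choices as above, and all $U\in\mathcal X^N$, $R_T(U)$ is integrable and $$\mathbb E[R_T(U)]\le C\sqrt{1+\ln N}\,\Big(\sum_{j=1}^N\sqrt{\textstyle\sum_{i\in\mathcal N_j}q_iw_{ij}^2}\,\sqrt{1+\sigma_j^2(N_j-1)}\Big)\sqrt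 T .$$ If moreover $w_{ij}=q_j/Q_i$ for all $i$ with $Q_i\ne0$ and all $j\in\mathcal N_i$, then $$\mathbb E[R_T(U)]\le C\sqrt{1+\ln N}\,\sqrt{1+\sigma_{\max}^2(N_{\max}-1)}\,\sqrt{\alpha(G)\,T}.$$ -/

import Mathlib

open scoped BigOperators

namespace MTCool

noncomputable section

/-! ### The base algorithm MT-FTRL on a clique with vertex set `ι` -/

/-- The vectors of `ℝ^d` with the Euclidean norm. -/
abbrev Vec (d : ℕ) := EuclideanSpace ℝ (Fin d)

/-- The decision space: the closed Euclidean unit ball. -/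
def decisionSet (d : ℕ) : Set (Vec d) := Metric.closedBall 0 1

/-- `g` is a subgradient at `x` of the function `f` considered on the set `S`. -/
def IsSubgradientOn {d : ℕ} (S : Set (Vec d)) (f : Vec d → ℝ) (x g : Vec d) : Prop :=
  ∀ y ∈ S, f x + inner ℝ g (y - x) ≤ f y

/-- The variance `(1/(N-1)) ∑ᵢ ‖Uᵢ - (1/N) ∑ₖ Uₖ‖²` of the rows of `U`, `N = |ι|`
(it is `0` when `N = 1`). -/
def taskVariance {ι : Type} [Fintype ι] {d : ℕ} (U : ι → Vec d) : ℝ :=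
  (1 / ((Fintype.card ι : ℝ) - 1)) *
    ∑ i, ‖U i - (1 / (Fintype.card ι : ℝ)) • ∑ k, U k‖ ^ 2

open Classical in
/-- The matrix `A = (1 + N) I - 𝟏 𝟏ᵀ`, `N = |ι|`. -/
def regMatrix (ι : Type) [Fintype ι] : Matrix ι ι ℝ :=
  (1 + (Fintype.card ι : ℝ)) • (1 : Matrix ι ι ℝ) - Matrix.of (fun _ _ => 1)

/-- The squared Mahalanobis norm `‖X‖_A² = tr (Xᵀ A X)`. -/
def mahalanobisSq {ι : Type} [Fintype ι] {d : ℕ} (X : ι → Vec d) : ℝ :=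
  ∑ i, ∑ k, regMatrix ι i k * inner ℝ (X i) (X k)

/-- The matrices with rows in the unit ball and with variance at most `ξ`. -/
def feasible (ι : Type) [Fintype ι] (d : ℕ) (ξ : ℝ) : Set (ι → Vec d) :=
  {X | (∀ i, X i ∈ decisionSet d) ∧ taskVariance X ≤ ξ}

/-- The linear loss `⟨G, X⟩` of one round, where `G` has `h` as row `i` and zeros elsewhere if the
clique is fed the pair `(i, h)`; it is `0` if the clique is fed nothing in that round. -/
def roundLoss {ι : Type} {d : ℕ} (o : Option (ι × Vec d)) (X : ι → Vec d) : ℝ :=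
  match o with
  | none => 0
  | some (i, h) => inner ℝ h (X i)

/-- The learning rate `η^{(ξ)} = (N / β) √(1 + ξ (N - 1))`, `N = |ι|`. -/
def expertRate (ι : Type) [Fintype ι] (β ξ : ℝ) : ℝ :=
  (Fintype.card ι : ℝ) / β * Real.sqrt (1 + ξ * ((Fintype.card ι : ℝ) - 1))

/-- The FTRL objective `η ⟨∑_{s<t} G_s, X⟩ + ½ ‖X‖_A²`. -/
def ftrlObjective {ι : Type} [Fintype ι] {d : ℕ} (fed : ℕ → Option (ι × Vec d)) (η : ℝ) (t : ℕ)
    (X : ι → Vec d) : ℝ :=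
  η * (∑ s ∈ Finset.range t, roundLoss (fed s) X) + 1 / 2 * mahalanobisSq X

/-- The prediction `X_t^{(ξ)}` of the expert `ξ`: the minimizer of the FTRL objective over the
feasible matrices. `β t` is the parameter that is used in round `t`. -/
def expertIterate {ι : Type} [Fintype ι] {d : ℕ} (fed : ℕ → Option (ι × Vec d)) (β : ℕ → ℝ)
    (ξ : ℝ) (t : ℕ) : ι → Vec d :=
  Classical.epsilon fun X =>
    X ∈ feasible ι d ξ ∧ IsMinOn (ftrlObjective fed (expertRate ι (β t) ξ) t) (feasible ι d ξ) X

/-- The minimizer in the definition of `expertIterate` exists. -/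
theorem expertIterate_spec {ι : Type} [Fintype ι] {d : ℕ} (fed : ℕ → Option (ι × Vec d))
    (β : ℕ → ℝ) {ξ : ℝ} (hξ : 0 ≤ ξ) (t : ℕ) :
    expertIterate fed β ξ t ∈ feasible ι d ξ ∧
      IsMinOn (ftrlObjective fed (expertRate ι (β t) ξ) t) (feasible ι d ξ)
        (expertIterate fed β ξ t) := by
  have hvar : Continuous (fun X : ι → Vec d => taskVariance X) := by
    unfold taskVariance
    fun_prop
  have hcomp : IsCompact (feasible ι d ξ) := by
    have h1 : IsCompact (Set.pi Set.univ fun _ : ι => decisionSet d) :=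
      isCompact_univ_pi fun _ => isCompact_closedBall _ _
    have h2 : feasible ι d ξ
        = (Set.pi Set.univ fun _ : ι => decisionSet d) ∩ {X | taskVariance X ≤ ξ} := by
      ext X
      simp [feasible]
    rw [h2]
    exact h1.inter_right (isClosed_le hvar continuous_const)
  have hne : (feasible ι d ξ).Nonempty :=
    ⟨0, by simp [decisionSet], by simpa [taskVariance] using hξ⟩
  have hround : ∀ o : Option (ι × Vec d), Continuous (fun X : ι → Vec d => roundLoss o X) := by
    intro o
    rcases o with _ | ⟨i, h⟩
    · exact continuous_const
    · simp only [roundLoss]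
      fun_prop
  have hobj : Continuous (ftrlObjective (d := d) fed (expertRate ι (β t) ξ) t) := by
    unfold ftrlObjective mahalanobisSq
    have := fun s => hround (fed s)
    fun_prop
  obtain ⟨X, hX, hmin⟩ := hcomp.exists_isMinOn hne hobj.continuousOn
  exact Classical.epsilon_spec (p := fun X => X ∈ feasible ι d ξ ∧
    IsMinOn (ftrlObjective fed (expertRate ι (β t) ξ) t) (feasible ι d ξ) X) ⟨X, hX, hmin⟩

/-- The `k`-th element of the grid `Ξ = {1/N, 2/N, …, 1}` of experts, for `1 ≤ k ≤ N = |ι|`. -/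
def gridPoint (ι : Type) [Fintype ι] (k : ℕ) : ℝ := (k : ℝ) / (Fintype.card ι : ℝ)

/-- The unnormalized Hedge weight of the expert `ξ` in round `t`:
`exp (-(√(ln N) / β_t) ∑_{s<t} ⟨G_s, X_s^{(ξ)}⟩)`. -/
def hedgeWeight {ι : Type} [Fintype ι] {d : ℕ} (fed : ℕ → Option (ι × Vec d)) (β : ℕ → ℝ)
    (t : ℕ) (ξ : ℝ) : ℝ :=
  Real.exp (-(Real.sqrt (Real.log (Fintype.card ι)) / β t *
    ∑ s ∈ Finset.range t, roundLoss (fed s) (expertIterate fed β ξ s)))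

/-- The Hedge probability of the `k`-th expert in round `t` (uniform in round `0`). -/
def hedgeProb {ι : Type} [Fintype ι] {d : ℕ} (fed : ℕ → Option (ι × Vec d)) (β : ℕ → ℝ)
    (t k : ℕ) : ℝ :=
  hedgeWeight fed β t (gridPoint ι k) /
    ∑ m ∈ Finset.Icc 1 (Fintype.card ι), hedgeWeight fed β t (gridPoint ι m)

/-- The prediction of MT-FTRL in round `t`: the average of the experts' predictions. It is a
function of what was fed in the rounds `s < t`. -/
def mtFTRL {ι : Type} [Fintype ι] {d : ℕ} (fed : ℕ → Option (ι × Vec d)) (β : ℕ → ℝ) (t : ℕ) :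
    ι → Vec d :=
  ∑ k ∈ Finset.Icc 1 (Fintype.card ι),
    hedgeProb fed β t k • expertIterate fed β (gridPoint ι k) t

/-! ### MT-COOL on a communication graph -/

open Classical in
/-- The closed neighborhood of `i`. -/
def nbhd {N : ℕ} (G : SimpleGraph (Fin N)) (i : Fin N) : Finset (Fin N) :=
  Finset.univ.filter fun j => j = i ∨ G.Adj i j

theorem mem_nbhd_symm {N : ℕ} {G : SimpleGraph (Fin N)} {i j : Fin N} (h : j ∈ nbhd G i) :
    i ∈ nbhd G j := by
  simp only [nbhd, Finset.mem_filter, Finset.mem_univ, true_and] at h ⊢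
  exact h.imp Eq.symm fun h => h.symm

/-- What agent `j` feeds to its instance of MT-FTRL in round `s`: the pair `(i_s, w_{i_s j} g_s)`
if the active agent `i_s` is in the closed neighborhood of `j`, and nothing otherwise. -/
def fedTo {N d : ℕ} (G : SimpleGraph (Fin N)) (w : Fin N → Fin N → ℝ) (act : ℕ → Fin N)
    (g : ℕ → Vec d) (j : Fin N) (s : ℕ) : Option ({i // i ∈ nbhd G j} × Vec d) :=
  if h : act s ∈ nbhd G j then some (⟨act s, h⟩, w (act s) j • g s) else none

/-- The local time of agent `j`: the number of rounds `s < t` with `i_s` in its neighborhood. -/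
def localTime {N : ℕ} (G : SimpleGraph (Fin N)) (act : ℕ → Fin N) (j : Fin N) (t : ℕ) : ℕ :=
  ((Finset.range t).filter fun s => act s ∈ nbhd G j).card

/-- `Q_j = ∑_{i ∈ N_j} q_i`. -/
def nbhdProb {N : ℕ} (G : SimpleGraph (Fin N)) (q : Fin N → ℝ) (j : Fin N) : ℝ :=
  ∑ i ∈ nbhd G j, q i

/-- The parameter of agent `j` in round `t`:
`√(∑_{i ∈ N_j} (q_i / Q_j) w_{ij}²) √(1 + #{s < t : i_s ∈ N_j})`. -/
def beta {N : ℕ} (G : SimpleGraph (Fin N)) (w : Fin N → Fin N → ℝ) (q : Fin N → ℝ)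
    (act : ℕ → Fin N) (j : Fin N) (t : ℕ) : ℝ :=
  Real.sqrt (∑ i ∈ nbhd G j, q i / nbhdProb G q j * w i j ^ 2) *
    Real.sqrt (1 + (localTime G act j t : ℝ))

/-- The matrix `Y_t^{(j)}` that the instance of MT-FTRL run by agent `j` maintains. -/
def localModel {N d : ℕ} (G : SimpleGraph (Fin N)) (w : Fin N → Fin N → ℝ) (q : Fin N → ℝ)
    (act : ℕ → Fin N) (g : ℕ → Vec d) (j : Fin N) (t : ℕ) : {i // i ∈ nbhd G j} → Vec d :=
  mtFTRL (fedTo G w act g j) (beta G w q act j) t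

/-- The prediction `x_t = ∑_{j ∈ N_{i_t}} w_{i_t j} [Y_t^{(j)}]_{i_t}` of MT-COOL, given the
activations `i_s` for `s ≤ t` and the subgradients `g_s` observed in the rounds `s < t`. -/
def prediction {N d : ℕ} (G : SimpleGraph (Fin N)) (w : Fin N → Fin N → ℝ) (q : Fin N → ℝ)
    (act : ℕ → Fin N) (g : ℕ → Vec d) (t : ℕ) : Vec d :=
  ∑ j : {j // j ∈ nbhd G (act t)},
    w (act t) j • localModel G w q act g j t ⟨act t, mem_nbhd_symm j.2⟩

/-- The multitask regret `R_T(U) = ∑_{t < T} (ℓ_t(x_t) - ℓ_t(U_{i_t}))` of MT-COOL. -/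
def regret {N d : ℕ} (G : SimpleGraph (Fin N)) (w : Fin N → Fin N → ℝ) (q : Fin N → ℝ)
    (ℓ : ℕ → Vec d → ℝ) (act : ℕ → Fin N) (g : ℕ → Vec d) (T : ℕ) (U : Fin N → Vec d) : ℝ :=
  ∑ t ∈ Finset.range T, (ℓ t (prediction G w q act g t) - ℓ t (U (act t)))

/-- The local task variance
`σ_j² = (1 / (2 N_j (N_j - 1))) ∑_{i, i' ∈ N_j} ‖U_i - U_{i'}‖²` (it is `0` when `N_j = 1`). -/
def localVariance {N d : ℕ} (G : SimpleGraph (Fin N)) (U : Fin N → Vec d) (j : Fin N) : ℝ :=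
  (1 / (2 * ((nbhd G j).card : ℝ) * (((nbhd G j).card : ℝ) - 1))) *
    ∑ i ∈ nbhd G j, ∑ i' ∈ nbhd G j, ‖U i - U i'‖ ^ 2

/-- `σ_max² = max_j σ_j²`. -/
def maxVariance {N d : ℕ} (G : SimpleGraph (Fin N)) (U : Fin N → Vec d) : ℝ :=
  ⨆ j, localVariance G U j

/-- `N_max = max_j N_j`. -/
def maxNbhd {N : ℕ} (G : SimpleGraph (Fin N)) : ℕ :=
  Finset.univ.sup fun j => (nbhd G j).card

end

end MTCool

open MTCool

open scoped BigOperators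

namespace MTCool

/-! ### The Mahalanobis norm -/

section Mahalanobis

variable {ι : Type} [Fintype ι] {d : ℕ}

/-! The proof rests on a reduction to constant comparators. The losses are fixed in advance and the
activations are identically distributed, so the comparator's expected loss is the `q`-average over
`i` of `∑ t, ℓ t (U i)`. Some deterministic row `U k` does at least as well, and MT-COOL only has to
compete with the matrix whose rows all equal `U k` (`exists_integral_regret_le_const`). The variance
factors in the theorem are at least `1` and are inserted only at the very end.

For a constant comparator, linearization splits the regret into one MT-FTRL regret per agent `j`,
because the weights of each agent sum to `1`. MT-FTRL is Hedge over FTRL experts, and a constant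
matrix has variance `0`, so the expert at the smallest grid point suffices. Its regret is controlled
by strong convexity in the Mahalanobis norm (`expert_regret`), and Hedge costs a further `√(ln N_j)`
(`hedge_regret`).

In expectation, `i_t` is independent of the local time before round `t`. This replaces the squared
weight fed to agent `j` by its mean, and a telescoping sum with Jensen's inequality gives a
contribution of order `√(∑ q_i w_ij²) √T` (`integral_localBound_le`). For `w_ij = q_j / Q_i`,
Cauchy–Schwarz and a weighted Caro–Wei bound turn the sum over `j` into `√α(G)`
(`sum_sqrt_le_sqrt_indepNum`). -/

theorem mahalanobisSq_eq (X : ι → Vec d) :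
    mahalanobisSq X = (1 + (Fintype.card ι : ℝ)) * ∑ i, ‖X i‖ ^ 2 - ‖∑ i, X i‖ ^ 2 := by
  classical
  have h : ‖∑ i, X i‖ ^ 2 = ∑ i, ∑ k, (inner ℝ (X i) (X k) : ℝ) := by
    rw [← real_inner_self_eq_norm_sq, sum_inner]
    simp_rw [inner_sum]
  rw [h, Finset.mul_sum, ← Finset.sum_sub_distrib, mahalanobisSq]
  refine Finset.sum_congr rfl fun i _ => ?_
  simp [regMatrix, Matrix.sub_apply, Matrix.smul_apply, Matrix.one_apply, sub_mul,
    Finset.sum_sub_distrib]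

/-- The symmetric bilinear form that belongs to `mahalanobisSq`. -/
noncomputable def mahalanobisForm (X D : ι → Vec d) : ℝ :=
  (1 + (Fintype.card ι : ℝ)) * ∑ i, inner ℝ (X i) (D i) - inner ℝ (∑ i, X i) (∑ i, D i)

theorem mahalanobisSq_add_smul (X D : ι → Vec d) (c : ℝ) :
    mahalanobisSq (X + c • D)
      = mahalanobisSq X + 2 * c * mahalanobisForm X D + c ^ 2 * mahalanobisSq D := by
  simp only [mahalanobisSq_eq, mahalanobisForm, Pi.add_apply, Pi.smul_apply,
    Finset.sum_add_distrib, ← Finset.smul_sum, norm_add_sq_real, inner_smul_right, norm_smul,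
    mul_pow, Real.norm_eq_abs, sq_abs, ← Finset.mul_sum]
  ring

/-- The dual norm of a matrix with a single nonzero row `h` is `√(2 / (1 + N)) ‖h‖`. -/
theorem le_mahalanobisSq (D : ι → Vec d) (i : ι) :
    (1 + (Fintype.card ι : ℝ)) / 2 * ‖D i‖ ^ 2 ≤ mahalanobisSq D := by
  classical
  -- Splitting row `i` into two equal halves gives `N + 1` vectors with the same sum, while the sum
  -- of squares drops by `‖D i‖² / 2`. Cauchy–Schwarz over `N + 1` terms then matches the
  -- coefficient `1 + N` of the norm.
  let f : Option ι → Vec d := fun o =>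
    o.elim ((1 / 2 : ℝ) • D i) fun k => if k = i then (1 / 2 : ℝ) • D i else D k
  have hsum : ∑ o, f o = ∑ k, D k := by
    rw [Fintype.sum_option, ← Finset.add_sum_erase _ _ (Finset.mem_univ i),
      ← Finset.add_sum_erase _ D (Finset.mem_univ i), ← add_assoc]
    congr 1
    · simp only [f, Option.elim, if_true, ← add_smul]
      norm_num
    · refine Finset.sum_congr rfl fun k hk => ?_
      simp [f, Finset.ne_of_mem_erase hk]
  have hsq : ∑ o, ‖f o‖ ^ 2 = ∑ k, ‖D k‖ ^ 2 - 1 / 2 * ‖D i‖ ^ 2 := by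
    rw [Fintype.sum_option, ← Finset.add_sum_erase _ _ (Finset.mem_univ i),
      ← Finset.add_sum_erase _ (fun k => ‖D k‖ ^ 2) (Finset.mem_univ i)]
    have : ∑ k ∈ Finset.univ.erase i, ‖f (some k)‖ ^ 2
        = ∑ k ∈ Finset.univ.erase i, ‖D k‖ ^ 2 := by
      refine Finset.sum_congr rfl fun k hk => ?_
      simp [f, Finset.ne_of_mem_erase hk]
    rw [this]
    simp only [f, Option.elim, if_true, norm_smul, mul_pow]
    norm_num
    ring
  have h1 : ‖∑ k, D k‖ ^ 2 ≤ (1 + (Fintype.card ι : ℝ)) * ∑ o, ‖f o‖ ^ 2 := by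
    rw [← hsum]
    refine (pow_le_pow_left₀ (norm_nonneg _) (norm_sum_le _ _) 2).trans ?_
    refine (sq_sum_le_card_mul_sum_sq (s := Finset.univ) (f := fun o => ‖f o‖)).trans_eq ?_
    simp [Fintype.card_option, add_comm]
  rw [mahalanobisSq_eq]
  rw [hsq] at h1
  linarith

theorem mahalanobisSq_nonneg (X : ι → Vec d) : 0 ≤ mahalanobisSq X := by
  rw [mahalanobisSq_eq]
  have h1 : ‖∑ k, X k‖ ^ 2 ≤ (Fintype.card ι : ℝ) * ∑ k, ‖X k‖ ^ 2 := by
    refine (pow_le_pow_left₀ (norm_nonneg _) (norm_sum_le _ _) 2).trans ?_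
    simpa using sq_sum_le_card_mul_sum_sq (s := Finset.univ) (f := fun o => ‖X o‖)
  have h2 : 0 ≤ ∑ k, ‖X k‖ ^ 2 := Finset.sum_nonneg fun _ _ => sq_nonneg _
  linarith

theorem mahalanobisSq_const (u : Vec d) :
    mahalanobisSq (fun _ : ι => u) = (Fintype.card ι : ℝ) * ‖u‖ ^ 2 := by
  rw [mahalanobisSq_eq]
  simp only [Finset.sum_const, Finset.card_univ, ← Nat.cast_smul_eq_nsmul ℝ,
    norm_smul, mul_pow, Real.norm_eq_abs, sq_abs]
  ring

end Mahalanobis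

/-! ### The regret of one expert -/

section Experts

variable {ι : Type} {d : ℕ}

/-- The squared norm of the nonzero row of a round loss. -/
noncomputable def roundSq (o : Option (ι × Vec d)) : ℝ := o.elim 0 fun p => ‖p.2‖ ^ 2

theorem roundSq_nonneg (o : Option (ι × Vec d)) : 0 ≤ roundSq o := by
  rcases o with _ | ⟨i, h⟩ <;> simp [roundSq]

theorem roundLoss_add (o : Option (ι × Vec d)) (X Y : ι → Vec d) :
    roundLoss o (X + Y) = roundLoss o X + roundLoss o Y := by
  rcases o with _ | ⟨i, h⟩ <;> simp [roundLoss, inner_add_right]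

theorem roundLoss_smul (o : Option (ι × Vec d)) (c : ℝ) (X : ι → Vec d) :
    roundLoss o (c • X) = c * roundLoss o X := by
  rcases o with _ | ⟨i, h⟩ <;> simp [roundLoss, inner_smul_right]

theorem roundLoss_sum_smul {κ : Type*} (o : Option (ι × Vec d)) (s : Finset κ) (c : κ → ℝ)
    (X : κ → ι → Vec d) :
    roundLoss o (∑ k ∈ s, c k • X k) = ∑ k ∈ s, c k * roundLoss o (X k) := by
  classical
  induction s using Finset.induction_on with
  | empty => rcases o with _ | ⟨i, h⟩ <;> simp [roundLoss]
  | insert a s ha ih => rw [Finset.sum_insert ha, Finset.sum_insert ha, roundLoss_add,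
      roundLoss_smul, ih]

theorem roundLoss_sq_le (o : Option (ι × Vec d)) {X : ι → Vec d}
    (hX : ∀ i, X i ∈ decisionSet d) : roundLoss o X ^ 2 ≤ roundSq o := by
  rcases o with _ | ⟨i, h⟩
  · simp [roundLoss, roundSq]
  · have h1 : ‖X i‖ ≤ 1 := by simpa [decisionSet] using hX i
    have h2 : |(inner ℝ h (X i) : ℝ)| ≤ ‖h‖ :=
      (abs_real_inner_le_norm _ _).trans (mul_le_of_le_one_right (norm_nonneg _) h1)
    simpa [roundLoss, roundSq] using sq_le_sq' (by linarith [abs_le.1 h2]) (abs_le.1 h2).2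

variable [Fintype ι]

theorem taskVariance_convexComb_le [Nonempty ι] (X Y : ι → Vec d) {a b : ℝ} (ha : 0 ≤ a)
    (hb : 0 ≤ b) (hab : a + b = 1) :
    taskVariance (a • X + b • Y) ≤ a * taskVariance X + b * taskVariance Y := by
  have hN : (1 : ℝ) ≤ Fintype.card ι := by exact_mod_cast Fintype.card_pos (α := ι)
  have hsq : ∀ x y : Vec d, ‖a • x + b • y‖ ^ 2 ≤ a * ‖x‖ ^ 2 + b * ‖y‖ ^ 2 := by
    intro x y
    have h1 : ‖a • x + b • y‖ ≤ a * ‖x‖ + b * ‖y‖ := by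
      refine (norm_add_le _ _).trans_eq ?_
      rw [norm_smul, norm_smul, Real.norm_of_nonneg ha, Real.norm_of_nonneg hb]
    refine (pow_le_pow_left₀ (norm_nonneg _) h1 2).trans ?_
    obtain rfl : b = 1 - a := by linarith
    nlinarith [mul_nonneg (mul_nonneg ha hb) (sq_nonneg (‖x‖ - ‖y‖))]
  unfold taskVariance
  rw [mul_left_comm a, mul_left_comm b, ← mul_add, Finset.mul_sum _ _ a, Finset.mul_sum _ _ b,
    ← Finset.sum_add_distrib]
  -- The prefactor `1 / (N - 1)` is nonnegative because `N ≥ 1`; for `N = 1` it is `1 / 0 = 0`.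
  refine mul_le_mul_of_nonneg_left (Finset.sum_le_sum fun i _ => ?_)
    (one_div_nonneg.2 (by linarith))
  refine le_of_eq_of_le ?_ (hsq _ _)
  congr 2
  simp only [Pi.add_apply, Pi.smul_apply, Finset.sum_add_distrib, ← Finset.smul_sum]
  module

theorem convex_feasible [Nonempty ι] (ξ : ℝ) : Convex ℝ (feasible ι d ξ) := by
  intro X hX Y hY a b ha hb hab
  refine ⟨fun i => convex_closedBall 0 1 (hX.1 i) (hY.1 i) ha hb hab, ?_⟩
  refine (taskVariance_convexComb_le X Y ha hb hab).trans ?_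
  have h1 := mul_le_mul_of_nonneg_left hX.2 ha
  have h2 := mul_le_mul_of_nonneg_left hY.2 hb
  have h3 : a * ξ + b * ξ = ξ := by rw [← add_mul, hab, one_mul]
  linarith

theorem ftrlObjective_add_smul (fed : ℕ → Option (ι × Vec d)) (η : ℝ) (t : ℕ)
    (X D : ι → Vec d) (c : ℝ) :
    ftrlObjective fed η t (X + c • D) = ftrlObjective fed η t X
      + c * (η * (∑ s ∈ Finset.range t, roundLoss (fed s) D) + mahalanobisForm X D)
      + c ^ 2 / 2 * mahalanobisSq D := by
  simp only [ftrlObjective, mahalanobisSq_add_smul, roundLoss_add, roundLoss_smul,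
    Finset.sum_add_distrib, ← Finset.mul_sum]
  ring

/-- The FTRL objective grows quadratically around its minimizer over a convex set. -/
theorem ftrlObjective_growth (fed : ℕ → Option (ι × Vec d)) (η : ℝ) (t : ℕ)
    {K : Set (ι → Vec d)} (hK : Convex ℝ K) {X Y : ι → Vec d} (hX : X ∈ K) (hY : Y ∈ K)
    (hmin : IsMinOn (ftrlObjective fed η t) K X) :
    ftrlObjective fed η t X + 1 / 2 * mahalanobisSq (Y - X) ≤ ftrlObjective fed η t Y := by
  set D := Y - X with hD
  set a := η * (∑ s ∈ Finset.range t, roundLoss (fed s) D) + mahalanobisForm X D with ha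
  have hm := mahalanobisSq_nonneg D
  have key : ∀ c : ℝ, 0 < c → c ≤ 1 → 0 ≤ a + c / 2 * mahalanobisSq D := by
    intro c hc hc1
    have hmem : X + c • D ∈ K := hK.add_smul_sub_mem hX hY ⟨hc.le, hc1⟩
    have h1 : ftrlObjective fed η t X ≤ ftrlObjective fed η t (X + c • D) := hmin hmem
    rw [ftrlObjective_add_smul] at h1
    have h2 : 0 ≤ c * (a + c / 2 * mahalanobisSq D) := by
      rw [← ha] at h1
      linarith
    exact nonneg_of_mul_nonneg_right h2 hc
  -- The directional derivative `a` at the minimizer is nonnegative: if `a < 0`, the step length `c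
  -- = min 1 (-a / (‖D‖_A² + 1))` is small enough to contradict `key`.
  have ha0 : 0 ≤ a := by
    by_contra! hneg
    have hm1 : 0 < mahalanobisSq D + 1 := by linarith
    have hc : 0 < min 1 (-a / (mahalanobisSq D + 1)) :=
      lt_min one_pos (div_pos (by linarith) hm1)
    have h1 := key _ hc (min_le_left _ _)
    have h2 : min 1 (-a / (mahalanobisSq D + 1)) * (mahalanobisSq D + 1) ≤ -a := by
      rw [← le_div_iff₀ hm1]
      exact min_le_right _ _
    linarith
  have h := ftrlObjective_add_smul fed η t X D 1
  have hXD : X + (1 : ℝ) • D = Y := by rw [hD, one_smul]; abel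
  rw [hXD, ← ha] at h
  linarith

/-- A Fenchel–Young inequality. The loss sees only one row of `D`, so `le_mahalanobisSq` reduces the
claim to completing a square in the norm of that row. -/
theorem roundLoss_dual_bound (o : Option (ι × Vec d)) (D : ι → Vec d) {η : ℝ} (hη : 0 < η) :
    -(η / (1 + (Fintype.card ι : ℝ)) * roundSq o)
      ≤ 1 / (2 * η) * mahalanobisSq D + roundLoss o D := by
  rcases o with _ | ⟨i, h⟩
  · have := mul_nonneg (by positivity : 0 ≤ 1 / (2 * η)) (mahalanobisSq_nonneg D)
    simpa [roundSq, roundLoss] using this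
  · have hc : (0 : ℝ) < 1 + Fintype.card ι := by positivity
    set c := 1 + (Fintype.card ι : ℝ)
    have h1 := mul_le_mul_of_nonneg_left (le_mahalanobisSq D i)
      (by positivity : 0 ≤ 1 / (2 * η))
    have h2 : -(‖h‖ * ‖D i‖) ≤ (inner ℝ h (D i) : ℝ) := (abs_le.1 (abs_real_inner_le_norm _ _)).1
    have h3 : ‖h‖ * ‖D i‖ ≤ 1 / (2 * η) * (c / 2 * ‖D i‖ ^ 2) + η / c * ‖h‖ ^ 2 := by
      have h4 : 1 / (2 * η) * (c / 2 * ‖D i‖ ^ 2) + η / c * ‖h‖ ^ 2 - ‖h‖ * ‖D i‖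
          = η / c * (c / (2 * η) * ‖D i‖ - ‖h‖) ^ 2 := by
        field_simp
        ring
      have h5 : 0 ≤ η / c * (c / (2 * η) * ‖D i‖ - ‖h‖) ^ 2 := by positivity
      linarith
    simp only [roundSq, roundLoss, Option.elim]
    linarith

theorem sqrt_expert_pos [Nonempty ι] {ξ : ℝ} (hξ : 0 ≤ ξ) :
    1 ≤ Real.sqrt (1 + ξ * ((Fintype.card ι : ℝ) - 1)) := by
  have hN : (1 : ℝ) ≤ Fintype.card ι := by exact_mod_cast Fintype.card_pos (α := ι)
  rw [Real.one_le_sqrt]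
  have := mul_nonneg hξ (sub_nonneg.2 hN)
  linarith

/-- The regret of FTRL with the time-varying learning rates of the expert `ξ`. -/
theorem expert_regret [Nonempty ι] (fed : ℕ → Option (ι × Vec d)) {β : ℕ → ℝ}
    (hβ : ∀ t, 0 < β t) (hmono : Monotone β) {ξ : ℝ} (hξ : 0 ≤ ξ) (T : ℕ) :
    ∀ X ∈ feasible ι d ξ,
      ∑ s ∈ Finset.range T, roundLoss (fed s) (expertIterate fed β ξ s)
        - ∑ s ∈ Finset.range T,
          expertRate ι (β s) ξ / (1 + (Fintype.card ι : ℝ)) * roundSq (fed s)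
      ≤ ∑ s ∈ Finset.range T, roundLoss (fed s) X
        + 1 / (2 * expertRate ι (β T) ξ) * mahalanobisSq X := by
  have hN : (0 : ℝ) < Fintype.card ι := by exact_mod_cast Fintype.card_pos (α := ι)
  have hS := sqrt_expert_pos (ι := ι) hξ
  have hη : ∀ t, 0 < expertRate ι (β t) ξ := fun t =>
    mul_pos (div_pos hN (hβ t)) (by linarith)
  have hanti : ∀ t, expertRate ι (β (t + 1)) ξ ≤ expertRate ι (β t) ξ := by
    intro t
    refine mul_le_mul_of_nonneg_right ?_ (by linarith)
    exact div_le_div_of_nonneg_left hN.le (hβ t) (hmono (Nat.le_succ t))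
  induction T with
  | zero =>
    intro X _
    have := mul_nonneg (by have := hη 0; positivity : 0 ≤ 1 / (2 * expertRate ι (β 0) ξ))
      (mahalanobisSq_nonneg X)
    simpa using this
  | succ T ih =>
    intro X hX
    obtain ⟨hmem, hmin⟩ := expertIterate_spec fed β hξ T
    set Y := expertIterate fed β ξ T
    -- The induction hypothesis holds for every comparator, so it may be used for the iterate `Y` of
    -- round `T` itself. Quadratic growth around `Y` leaves a term in `X - Y`, which `h3` trades
    -- against the change of the round-`T` loss from `Y` to `X`.
    have h1 := ih Y hmem
    have h2 := ftrlObjective_growth fed _ T (convex_feasible ξ) hmem hX hmin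
    have h3 := roundLoss_dual_bound (fed T) (X - Y) (hη T)
    have h4 : roundLoss (fed T) X = roundLoss (fed T) Y + roundLoss (fed T) (X - Y) := by
      rw [← roundLoss_add, add_sub_cancel]
    have h5 : 1 / (2 * expertRate ι (β T) ξ) * mahalanobisSq X
        ≤ 1 / (2 * expertRate ι (β (T + 1)) ξ) * mahalanobisSq X := by
      refine mul_le_mul_of_nonneg_right ?_ (mahalanobisSq_nonneg X)
      refine one_div_le_one_div_of_le ?_ ?_
      · linarith [hη (T + 1)]
      · linarith [hanti T]
    have h6 : ∑ s ∈ Finset.range T, roundLoss (fed s) Y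
        + 1 / (2 * expertRate ι (β T) ξ) * mahalanobisSq Y
        + 1 / (2 * expertRate ι (β T) ξ) * mahalanobisSq (X - Y)
        ≤ ∑ s ∈ Finset.range T, roundLoss (fed s) X
        + 1 / (2 * expertRate ι (β T) ξ) * mahalanobisSq X := by
      have h7 := mul_le_mul_of_nonneg_left h2 (one_div_pos.2 (hη T)).le
      simp only [ftrlObjective] at h7
      have hne := (hη T).ne'
      field_simp at h7 ⊢
      linarith
    rw [Finset.sum_range_succ, Finset.sum_range_succ, Finset.sum_range_succ]
    linarith

end Experts

/-! ### The exponentially weighted average forecaster -/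

section Hedge

variable {κ : Type*}

/-- A version of Hoeffding's lemma for finite mixtures. -/
theorem sum_mul_exp_neg_le (s : Finset κ) (p y : κ → ℝ) (hp : ∀ k ∈ s, 0 ≤ p k)
    (hp1 : ∑ k ∈ s, p k = 1) {c : ℝ} (hc : 0 ≤ c) (hy : ∀ k ∈ s, |y k| ≤ c) :
    ∑ k ∈ s, p k * Real.exp (-y k) ≤ Real.exp (-(∑ k ∈ s, p k * y k) + 2 * c ^ 2) := by
  set m := ∑ k ∈ s, p k * y k with hm
  have hmc : |m| ≤ c := by
    refine (Finset.abs_sum_le_sum_abs _ _).trans ?_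
    calc ∑ k ∈ s, |p k * y k| ≤ ∑ k ∈ s, p k * c := by
          refine Finset.sum_le_sum fun k hk => ?_
          rw [abs_mul, abs_of_nonneg (hp k hk)]
          exact mul_le_mul_of_nonneg_left (hy k hk) (hp k hk)
      _ = c := by rw [← Finset.sum_mul, hp1, one_mul]
  -- The chord of the exponential over `[-2c, 2c]`, an interval that contains every deviation `m - y
  -- k`. Its linear part averages to zero, and `cosh (2c) ≤ exp (2c²)` explains the constant.
  have hpt : ∀ k ∈ s, Real.exp (m - y k)
      ≤ Real.cosh (2 * c) + (m - y k) / (2 * c) * Real.sinh (2 * c) := by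
    intro k hk
    have hz : |m - y k| ≤ 2 * c := by
      refine (abs_sub _ _).trans ?_
      linarith [hy k hk]
    have ht : |(m - y k) / (2 * c)| ≤ 1 := by
      rw [abs_div, abs_of_nonneg (by linarith : 0 ≤ 2 * c)]
      exact div_le_one_of_le₀ hz (by linarith)
    have h := Real.exp_mul_le_cosh_add_mul_sinh ht (2 * c)
    rwa [div_mul_cancel_of_imp] at h
    intro h0
    rw [h0] at hz
    exact abs_eq_zero.1 (le_antisymm hz (abs_nonneg _))
  have hmean : ∑ k ∈ s, p k * (m - y k) = 0 := by
    simp_rw [mul_sub]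
    rw [Finset.sum_sub_distrib, ← Finset.sum_mul, hp1, one_mul, ← hm, sub_self]
  have h1 : ∑ k ∈ s, p k * Real.exp (m - y k) ≤ Real.cosh (2 * c) := by
    calc ∑ k ∈ s, p k * Real.exp (m - y k)
        ≤ ∑ k ∈ s, (p k * Real.cosh (2 * c)
            + p k * (m - y k) * (Real.sinh (2 * c) / (2 * c))) := by
          refine Finset.sum_le_sum fun k hk => ?_
          refine (mul_le_mul_of_nonneg_left (hpt k hk) (hp k hk)).trans_eq ?_
          ring
      _ = Real.cosh (2 * c) := by
          rw [Finset.sum_add_distrib, ← Finset.sum_mul, ← Finset.sum_mul, hp1, hmean]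
          ring
  have h2 : ∑ k ∈ s, p k * Real.exp (-y k)
      = Real.exp (-m) * ∑ k ∈ s, p k * Real.exp (m - y k) := by
    rw [Finset.mul_sum]
    refine Finset.sum_congr rfl fun k _ => ?_
    rw [mul_left_comm, ← Real.exp_add]
    congr 2
    ring
  rw [h2, Real.exp_add]
  refine mul_le_mul_of_nonneg_left (h1.trans ((Real.cosh_le_exp_half_sq _).trans_eq ?_))
    (Real.exp_pos _).le
  congr 1
  ring

/-- The regret of the exponentially weighted average forecaster with nonincreasing learning
rates `η` against losses with squares at most `r`. -/
theorem hedge_regret (s : Finset κ) (hs : s.Nonempty) (ℓ : ℕ → κ → ℝ) (r η : ℕ → ℝ)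
    (hη : ∀ t, 0 < η t) (hanti : ∀ t, η (t + 1) ≤ η t) (hr : ∀ t, ∀ k ∈ s, ℓ t k ^ 2 ≤ r t)
    (T : ℕ) {k₀ : κ} (hk₀ : k₀ ∈ s) :
    ∑ t ∈ Finset.range T, ∑ k ∈ s,
        Real.exp (-(η t * ∑ u ∈ Finset.range t, ℓ u k))
          / (∑ m ∈ s, Real.exp (-(η t * ∑ u ∈ Finset.range t, ℓ u m))) * ℓ t k
      ≤ ∑ t ∈ Finset.range T, ℓ t k₀ + Real.log s.card / η T
        + ∑ t ∈ Finset.range T, 2 * η t * r t := by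
  set W : ℝ → ℕ → ℝ := fun a t => ∑ m ∈ s, Real.exp (-(a * ∑ u ∈ Finset.range t, ℓ u m)) with hW
  have hcard : (0 : ℝ) < s.card := by exact_mod_cast hs.card_pos
  have hWpos : ∀ a t, 0 < W a t := fun a t => Finset.sum_pos (fun _ _ => Real.exp_pos _) hs
  -- The potential is `log (W / |s|) / η`. Using the mean instead of the sum of the weights makes it
  -- start at `0` and lets it be compared across different rates.
  have key : ∀ T, ∑ t ∈ Finset.range T, ∑ k ∈ s,
        Real.exp (-(η t * ∑ u ∈ Finset.range t, ℓ u k)) / W (η t) t * ℓ t k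
        - ∑ t ∈ Finset.range T, 2 * η t * r t ≤ -(Real.log (W (η T) T / s.card) / η T) := by
    intro T
    induction T with
    | zero =>
      have : W (η 0) 0 / s.card = 1 := by
        simp [hW, hcard.ne']
      rw [this]
      simp
    | succ T ih =>
      rw [Finset.sum_range_succ, Finset.sum_range_succ]
      set p : κ → ℝ := fun k => Real.exp (-(η T * ∑ u ∈ Finset.range T, ℓ u k)) / W (η T) T
        with hp
      have hr0 : 0 ≤ r T := (sq_nonneg _).trans (hr T k₀ hk₀)
      have hstep : W (η T) (T + 1) ≤ W (η T) T *
          Real.exp (-(η T * ∑ k ∈ s, p k * ℓ T k) + 2 * (η T ^ 2 * r T)) := by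
        have h1 := sum_mul_exp_neg_le s p (fun k => η T * ℓ T k)
          (fun k _ => div_nonneg (Real.exp_pos _).le (hWpos _ _).le)
          (by rw [hp, ← Finset.sum_div]; exact div_self (hWpos _ _).ne')
          (c := η T * Real.sqrt (r T)) (mul_nonneg (hη T).le (Real.sqrt_nonneg _))
          (fun k hk => by
            rw [abs_mul, abs_of_pos (hη T)]
            exact mul_le_mul_of_nonneg_left (Real.abs_le_sqrt (hr T k hk)) (hη T).le)
        have h2 : W (η T) (T + 1) = W (η T) T * ∑ k ∈ s, p k * Real.exp (-(η T * ℓ T k)) := by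
          rw [Finset.mul_sum]
          refine Finset.sum_congr rfl fun k _ => ?_
          rw [hp, Finset.sum_range_succ, mul_add, neg_add, Real.exp_add]
          have := (hWpos (η T) T).ne'
          field_simp
        rw [h2]
        refine mul_le_mul_of_nonneg_left (h1.trans_eq ?_) (hWpos _ _).le
        rw [mul_pow, Real.sq_sqrt hr0, Finset.mul_sum]
        congr 3
        exact Finset.sum_congr rfl fun k _ => by ring
      -- Change of rate: by the power mean inequality with exponent `η T / η (T + 1) ≥ 1`, the
      -- potential is monotone in the rate when the cumulative losses are held fixed.
      have hpow : Real.log (W (η (T + 1)) (T + 1) / s.card) / η (T + 1)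
          ≤ Real.log (W (η T) (T + 1) / s.card) / η T := by
        have hη' := hη (T + 1)
        have h1 := Real.rpow_arith_mean_le_arith_mean_rpow s (fun _ => 1 / (s.card : ℝ))
          (fun k => Real.exp (-(η (T + 1) * ∑ u ∈ Finset.range (T + 1), ℓ u k)))
          (fun _ _ => by positivity) (by simp [hcard.ne']) (fun _ _ => (Real.exp_pos _).le)
          (p := η T / η (T + 1)) ((one_le_div hη').2 (hanti T))
        have h2 : ∀ k, Real.exp (-(η (T + 1) * ∑ u ∈ Finset.range (T + 1), ℓ u k))
            ^ (η T / η (T + 1)) = Real.exp (-(η T * ∑ u ∈ Finset.range (T + 1), ℓ u k)) := by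
          intro k
          rw [← Real.exp_mul]
          congr 1
          field_simp
        simp only [h2, one_div_mul_eq_div, ← Finset.sum_div] at h1
        have h3 := Real.log_le_log
          (Real.rpow_pos_of_pos (div_pos (hWpos (η (T + 1)) (T + 1)) hcard) _) h1
        rw [Real.log_rpow (div_pos (hWpos (η (T + 1)) (T + 1)) hcard)] at h3
        rw [div_le_div_iff₀ hη' (hη T)]
        rw [div_mul_eq_mul_div, div_le_iff₀ hη'] at h3
        linarith
      have hlog : Real.log (W (η T) (T + 1) / s.card) ≤ Real.log (W (η T) T / s.card)
          + (-(η T * ∑ k ∈ s, p k * ℓ T k) + 2 * (η T ^ 2 * r T)) := by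
        rw [← Real.log_exp (-(η T * ∑ k ∈ s, p k * ℓ T k) + 2 * (η T ^ 2 * r T)),
          ← Real.log_mul (div_pos (hWpos _ _) hcard).ne' (Real.exp_pos _).ne']
        refine Real.log_le_log (div_pos (hWpos _ _) hcard) ?_
        rw [div_mul_eq_mul_div]
        exact div_le_div_of_nonneg_right hstep hcard.le
      have hdiv := div_le_div_of_nonneg_right hlog (hη T).le
      have hexp : (Real.log (W (η T) T / s.card)
          + (-(η T * ∑ k ∈ s, p k * ℓ T k) + 2 * (η T ^ 2 * r T))) / η T
          = Real.log (W (η T) T / s.card) / η T - ∑ k ∈ s, p k * ℓ T k + 2 * η T * r T := by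
        have := (hη T).ne'
        field_simp
        ring
      rw [hexp] at hdiv
      linarith
  have h1 := key T
  have h2 : -(η T * ∑ u ∈ Finset.range T, ℓ u k₀) - Real.log s.card
      ≤ Real.log (W (η T) T / s.card) := by
    rw [Real.log_div (hWpos _ _).ne' hcard.ne']
    refine sub_le_sub_right ?_ _
    rw [Real.le_log_iff_exp_le (hWpos _ _)]
    exact Finset.single_le_sum (f := fun m => Real.exp (-(η T * ∑ u ∈ Finset.range T, ℓ u m)))
      (fun _ _ => (Real.exp_pos _).le) hk₀
  have h3 := div_le_div_of_nonneg_right h2 (hη T).le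
  have h4 : (-(η T * ∑ u ∈ Finset.range T, ℓ u k₀) - Real.log s.card) / η T
      = -(∑ u ∈ Finset.range T, ℓ u k₀) - Real.log s.card / η T := by
    have := (hη T).ne'
    field_simp
  rw [h4] at h3
  linarith

end Hedge

/-! ### The regret of MT-FTRL -/

section Clique

variable {ι : Type} [Fintype ι] [Nonempty ι] {d : ℕ}

theorem sum_hedgeProb (fed : ℕ → Option (ι × Vec d)) (β : ℕ → ℝ) (t : ℕ) :
    ∑ k ∈ Finset.Icc 1 (Fintype.card ι), hedgeProb fed β t k = 1 := by
  simp only [hedgeProb, ← Finset.sum_div]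
  refine div_self (Finset.sum_pos (fun _ _ => Real.exp_pos _) ?_).ne'
  exact ⟨1, Finset.mem_Icc.2 ⟨le_rfl, Fintype.card_pos⟩⟩

theorem gridPoint_nonneg (k : ℕ) : 0 ≤ gridPoint ι k := by
  unfold gridPoint
  positivity

/-- MT-FTRL is competitive with each of its experts. -/
theorem mtFTRL_le_expert (fed : ℕ → Option (ι × Vec d)) {β : ℕ → ℝ}
    (hβ : ∀ t, 0 < β t) (hmono : Monotone β) (T : ℕ) {k : ℕ}
    (hk : k ∈ Finset.Icc 1 (Fintype.card ι)) :
    ∑ t ∈ Finset.range T, roundLoss (fed t) (mtFTRL fed β t)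
      ≤ ∑ t ∈ Finset.range T, roundLoss (fed t) (expertIterate fed β (gridPoint ι k) t)
        + Real.sqrt (Real.log (Fintype.card ι)) *
          (β T + 2 * ∑ t ∈ Finset.range T, roundSq (fed t) / β t) := by
  have hpos : 1 ≤ Fintype.card ι := Fintype.card_pos
  rcases hpos.eq_or_lt with hN | hN
  -- A one-vertex clique is separate: `ln 1 = 0` makes the Hedge rate vanish, while `hedge_regret`
  -- needs positive rates. There is only one expert, so nothing is lost.
  · have hk1 : k = 1 := by
      rw [← hN] at hk
      simpa using hk
    have hp : ∀ t, hedgeProb fed β t 1 = 1 := by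
      intro t
      have := sum_hedgeProb fed β t
      rw [← hN] at this
      simpa using this
    subst hk1
    have h1 : ∀ t, mtFTRL fed β t = expertIterate fed β (gridPoint ι 1) t := by
      intro t
      rw [mtFTRL, ← hN]
      simp [hp]
    simp [h1, ← hN]
  · set L := Real.sqrt (Real.log (Fintype.card ι)) with hL
    have hlog : 0 < Real.log (Fintype.card ι) := Real.log_pos (by exact_mod_cast hN)
    have hLpos : 0 < L := Real.sqrt_pos.2 hlog
    have hLsq : L * L = Real.log (Fintype.card ι) := Real.mul_self_sqrt hlog.le
    have h := hedge_regret (Finset.Icc 1 (Fintype.card ι)) ⟨k, hk⟩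
      (fun t m => roundLoss (fed t) (expertIterate fed β (gridPoint ι m) t))
      (fun t => roundSq (fed t)) (fun t => L / β t) (fun t => div_pos hLpos (hβ t))
      (fun t => div_le_div_of_nonneg_left hLpos.le (hβ t) (hmono (Nat.le_succ t)))
      (fun t m _ => roundLoss_sq_le _ (expertIterate_spec fed β (gridPoint_nonneg m) t).1.1) T hk
    have h1 : ∀ t, roundLoss (fed t) (mtFTRL fed β t) = ∑ m ∈ Finset.Icc 1 (Fintype.card ι),
        hedgeProb fed β t m * roundLoss (fed t) (expertIterate fed β (gridPoint ι m) t) :=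
      fun t => roundLoss_sum_smul _ _ _ _
    simp only [h1]
    refine h.trans_eq ?_
    rw [Nat.card_Icc, Nat.add_sub_cancel, ← hLsq, mul_add, ← add_assoc, Finset.mul_sum,
      Finset.mul_sum]
    congr 2
    · have := (hβ T).ne'
      field_simp
    · funext t
      ring

/-- The regret of MT-FTRL against the comparators that are feasible for one of the experts. -/
theorem mtFTRL_regret (fed : ℕ → Option (ι × Vec d)) {β : ℕ → ℝ}
    (hβ : ∀ t, 0 < β t) (hmono : Monotone β) (T : ℕ) {k : ℕ}
    (hk : k ∈ Finset.Icc 1 (Fintype.card ι)) {X : ι → Vec d}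
    (hX : X ∈ feasible ι d (gridPoint ι k)) :
    ∑ t ∈ Finset.range T, (roundLoss (fed t) (mtFTRL fed β t) - roundLoss (fed t) X)
      ≤ (mahalanobisSq X / (2 * (Fintype.card ι : ℝ)) + Real.sqrt (Real.log (Fintype.card ι))) * β T
        + (Real.sqrt (1 + gridPoint ι k * ((Fintype.card ι : ℝ) - 1))
          + 2 * Real.sqrt (Real.log (Fintype.card ι)))
            * ∑ t ∈ Finset.range T, roundSq (fed t) / β t := by
  have hN : (0 : ℝ) < Fintype.card ι := by exact_mod_cast Fintype.card_pos (α := ι)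
  have hS := sqrt_expert_pos (ι := ι) (gridPoint_nonneg (ι := ι) k)
  have h1 := mtFTRL_le_expert fed hβ hmono T hk
  have h2 := expert_regret fed hβ hmono (gridPoint_nonneg k) T X hX
  set S := Real.sqrt (1 + gridPoint ι k * ((Fintype.card ι : ℝ) - 1)) with hSdef
  have h3 : ∑ s ∈ Finset.range T, expertRate ι (β s) (gridPoint ι k)
      / (1 + (Fintype.card ι : ℝ)) * roundSq (fed s)
      ≤ S * ∑ t ∈ Finset.range T, roundSq (fed t) / β t := by
    rw [Finset.mul_sum]
    refine Finset.sum_le_sum fun t _ => ?_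
    have h4 : expertRate ι (β t) (gridPoint ι k) / (1 + (Fintype.card ι : ℝ)) * roundSq (fed t)
        = (Fintype.card ι : ℝ) / (1 + Fintype.card ι) * (S * (roundSq (fed t) / β t)) := by
      simp only [expertRate, ← hSdef]
      ring
    rw [h4]
    refine mul_le_of_le_one_left ?_ ?_
    · exact mul_nonneg (by linarith) (div_nonneg (roundSq_nonneg _) (hβ t).le)
    · rw [div_le_one (by linarith)]
      linarith
  -- Discarding the factor `1 / S ≤ 1` is harmless for constant comparators: at the smallest grid
  -- point, `S` is bounded.
  have h5 : 1 / (2 * expertRate ι (β T) (gridPoint ι k)) * mahalanobisSq X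
      ≤ mahalanobisSq X / (2 * (Fintype.card ι : ℝ)) * β T := by
    have h6 : 1 / (2 * expertRate ι (β T) (gridPoint ι k)) * mahalanobisSq X
        = 1 / S * (mahalanobisSq X / (2 * (Fintype.card ι : ℝ)) * β T) := by
      simp only [expertRate, ← hSdef]
      have := (hβ T).ne'
      field_simp
    rw [h6]
    refine mul_le_of_le_one_left ?_ ?_
    · exact mul_nonneg (div_nonneg (mahalanobisSq_nonneg X) (by linarith)) (hβ T).le
    · rw [div_le_one (by linarith)]
      exact hS
  rw [Finset.sum_sub_distrib]
  linarith

theorem const_mem_feasible {u : Vec d} (hu : u ∈ decisionSet d) {ξ : ℝ} (hξ : 0 ≤ ξ) :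
    (fun _ : ι => u) ∈ feasible ι d ξ := by
  refine ⟨fun _ => hu, le_of_eq_of_le ?_ hξ⟩
  have hN : (Fintype.card ι : ℝ) ≠ 0 := by exact_mod_cast Fintype.card_ne_zero
  have : u - (1 / (Fintype.card ι : ℝ)) • ∑ _k : ι, u = 0 := by
    rw [Finset.sum_const, Finset.card_univ, ← Nat.cast_smul_eq_nsmul ℝ, smul_smul,
      one_div_mul_cancel hN, one_smul, sub_self]
  simp only [taskVariance, this]
  simp

/-- The regret of MT-FTRL against comparators with equal rows. -/
theorem mtFTRL_regret_const (fed : ℕ → Option (ι × Vec d)) {β : ℕ → ℝ}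
    (hβ : ∀ t, 0 < β t) (hmono : Monotone β) (T : ℕ) {u : Vec d} (hu : u ∈ decisionSet d) :
    ∑ t ∈ Finset.range T, (roundLoss (fed t) (mtFTRL fed β t) - roundLoss (fed t) fun _ => u)
      ≤ Real.sqrt (1 + Real.log (Fintype.card ι)) *
        (2 * β T + 4 * ∑ t ∈ Finset.range T, roundSq (fed t) / β t) := by
  have hN : (1 : ℝ) ≤ Fintype.card ι := by exact_mod_cast Fintype.card_pos (α := ι)
  have hlog : 0 ≤ Real.log (Fintype.card ι) := Real.log_nonneg hN
  -- Zero variance allows the first grid point `ξ = 1 / N`, where `√(1 + ξ (N - 1))` is at most `2`.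
  have h := mtFTRL_regret fed hβ hmono T (Finset.mem_Icc.2 ⟨le_rfl, Fintype.card_pos⟩)
    (const_mem_feasible hu (gridPoint_nonneg 1))
  refine h.trans ?_
  have hA : 1 ≤ Real.sqrt (1 + Real.log (Fintype.card ι)) := by
    rw [Real.one_le_sqrt]
    linarith
  have hB : Real.sqrt (Real.log (Fintype.card ι)) ≤ Real.sqrt (1 + Real.log (Fintype.card ι)) :=
    Real.sqrt_le_sqrt (by linarith)
  have hC : Real.sqrt (1 + gridPoint ι 1 * ((Fintype.card ι : ℝ) - 1)) ≤ 2 := by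
    rw [Real.sqrt_le_left (by norm_num)]
    have : gridPoint ι 1 * ((Fintype.card ι : ℝ) - 1) ≤ 1 := by
      rw [gridPoint, Nat.cast_one, one_div_mul_eq_div, div_le_one (by linarith)]
      linarith
    linarith
  have hD : mahalanobisSq (fun _ : ι => u) / (2 * (Fintype.card ι : ℝ)) ≤ 1 := by
    have hu1 : ‖u‖ ≤ 1 := by simpa [decisionSet] using hu
    rw [mahalanobisSq_const, div_le_one (by linarith)]
    have : ‖u‖ ^ 2 ≤ 1 := pow_le_one₀ (norm_nonneg _) hu1
    nlinarith
  have hE : 0 ≤ ∑ t ∈ Finset.range T, roundSq (fed t) / β t :=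
    Finset.sum_nonneg fun t _ => div_nonneg (roundSq_nonneg _) (hβ t).le
  have h1 := mul_le_mul_of_nonneg_right (by linarith :
    mahalanobisSq (fun _ : ι => u) / (2 * (Fintype.card ι : ℝ))
      + Real.sqrt (Real.log (Fintype.card ι))
      ≤ 2 * Real.sqrt (1 + Real.log (Fintype.card ι))) (hβ T).le
  have h2 := mul_le_mul_of_nonneg_right (by linarith :
    Real.sqrt (1 + gridPoint ι 1 * ((Fintype.card ι : ℝ) - 1))
      + 2 * Real.sqrt (Real.log (Fintype.card ι))
      ≤ 4 * Real.sqrt (1 + Real.log (Fintype.card ι))) hE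
  linarith

end Clique

/-! ### Nonanticipation -/

section Congr

/-- The iterate is a choice by `Classical.epsilon`, so equality follows once the two objectives are
equal as functions; no uniqueness of minimizers is needed. -/
theorem expertIterate_congr {ι : Type} [Fintype ι] {d : ℕ} {fed fed' : ℕ → Option (ι × Vec d)}
    {β β' : ℕ → ℝ} {t : ℕ} (hfed : ∀ s < t, fed s = fed' s) (hβ : β t = β' t) (ξ : ℝ) :
    expertIterate fed β ξ t = expertIterate fed' β' ξ t := by
  have h : ftrlObjective fed (expertRate ι (β t) ξ) t
      = ftrlObjective fed' (expertRate ι (β' t) ξ) t := by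
    funext X
    rw [ftrlObjective, ftrlObjective, hβ, Finset.sum_congr rfl fun s hs => by
      rw [hfed s (Finset.mem_range.1 hs)]]
  rw [expertIterate, expertIterate, h]

theorem mtFTRL_congr {ι : Type} [Fintype ι] {d : ℕ} {fed fed' : ℕ → Option (ι × Vec d)}
    {β β' : ℕ → ℝ} {t : ℕ} (hfed : ∀ s < t, fed s = fed' s) (hβ : ∀ s ≤ t, β s = β' s) :
    mtFTRL fed β t = mtFTRL fed' β' t := by
  have hW : hedgeWeight fed β t = hedgeWeight fed' β' t := by
    funext ξ
    rw [hedgeWeight, hedgeWeight, hβ t le_rfl, Finset.sum_congr rfl fun s hs => by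
      have hs := Finset.mem_range.1 hs
      rw [hfed s hs, expertIterate_congr (fun u hu => hfed u (hu.trans hs)) (hβ s hs.le)]]
  refine Finset.sum_congr rfl fun k _ => ?_
  rw [hedgeProb, hedgeProb, hW, expertIterate_congr hfed (hβ t le_rfl)]

variable {N d : ℕ} (G : SimpleGraph (Fin N)) (w : Fin N → Fin N → ℝ) (q : Fin N → ℝ)

theorem localTime_congr {a a' : ℕ → Fin N} {t : ℕ} (h : ∀ s < t, a s = a' s) (j : Fin N) :
    localTime G a j t = localTime G a' j t := by
  rw [localTime, localTime, Finset.filter_congr fun s hs => by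
    rw [h s (Finset.mem_range.1 hs)]]

theorem localModel_congr {a a' : ℕ → Fin N} {g g' : ℕ → Vec d} {t : ℕ}
    (h : ∀ s < t, a s = a' s) (hg : ∀ s < t, g s = g' s) (j : Fin N) :
    localModel G w q a g j t = localModel G w q a' g' j t := by
  refine mtFTRL_congr (fun s hs => ?_) fun s hs => ?_
  · simp only [fedTo, h s hs, hg s hs]
  · rw [beta, beta, localTime_congr G fun u hu => h u (hu.trans_le hs)]

theorem prediction_congr {a a' : ℕ → Fin N} {g g' : ℕ → Vec d} {t : ℕ}
    (h : ∀ s ≤ t, a s = a' s) (hg : ∀ s < t, g s = g' s) :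
    prediction G w q a g t = prediction G w q a' g' t := by
  -- The active agent occurs in the index type of the sum and in the membership proofs, so it is
  -- generalized before being replaced.
  have key : ∀ (i i' : Fin N) (_ : i = i') (M : ∀ j, {i // i ∈ nbhd G j} → Vec d),
      ∑ j : {j // j ∈ nbhd G i}, w i j • M j ⟨i, mem_nbhd_symm j.2⟩
        = ∑ j : {j // j ∈ nbhd G i'}, w i' j • M j ⟨i', mem_nbhd_symm j.2⟩ := by
    rintro i _ rfl M
    rfl
  simp only [prediction, localModel_congr G w q (fun s hs => h s (Nat.le_of_lt hs)) hg]
  exact key _ _ (h t le_rfl) fun j => localModel G w q a' g' j t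

/-- This makes the regret a function on the finite set of activation sequences of length `T`, whence
its integrability without any measurability of losses or subgradients. -/
theorem dependsOn_regret (ℓ : ℕ → Vec d → ℝ) (U : Fin N → Vec d)
    {g : (ℕ → Fin N) → ℕ → Vec d}
    (hg : ∀ a a' : ℕ → Fin N, ∀ t, (∀ s ≤ t, a s = a' s) → g a t = g a' t) (T : ℕ) :
    DependsOn (fun a => regret G w q ℓ a (g a) T U) (Set.Iio T) := by
  intro a a' h
  refine Finset.sum_congr rfl fun t ht => ?_
  have ht := Finset.mem_range.1 ht
  rw [h t ht, prediction_congr G w q (fun s hs => h s (hs.trans_lt ht))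
    fun s hs => hg a a' s fun u hu => h u (hu.trans_lt (hs.trans ht))]

end Congr

/-! ### The regret of MT-COOL along one sequence of activations -/

section Pathwise

variable {N d : ℕ} (G : SimpleGraph (Fin N)) (w : Fin N → Fin N → ℝ) (q : Fin N → ℝ)

theorem self_mem_nbhd (i : Fin N) : i ∈ nbhd G i := by
  simp [nbhd]

theorem localTime_succ (a : ℕ → Fin N) (j : Fin N) (t : ℕ) :
    localTime G a j (t + 1) = localTime G a j t + if a t ∈ nbhd G j then 1 else 0 := by
  rw [localTime, localTime, Finset.range_add_one, Finset.filter_insert]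
  split_ifs with h
  · rw [Finset.card_insert_of_notMem (by simp)]
  · rfl

theorem localTime_eq_sum (a : ℕ → Fin N) (j : Fin N) (T : ℕ) :
    (localTime G a j T : ℝ) = ∑ t ∈ Finset.range T, if a t ∈ nbhd G j then (1 : ℝ) else 0 := by
  simp [localTime]

theorem localTime_mono (a : ℕ → Fin N) (j : Fin N) : Monotone (localTime G a j) :=
  monotone_nat_of_le_succ fun t => by rw [localTime_succ]; exact Nat.le_add_right _ _

/-- Telescoping: `1 / √(1 + n) ≤ 2 √(1 + n) - 2 √n`, and a term is added exactly in the rounds that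
raise the local time from `n` to `n + 1`. -/
theorem sum_inv_sqrt_localTime_le (a : ℕ → Fin N) (j : Fin N) (T : ℕ) :
    ∑ t ∈ Finset.range T,
        1 / Real.sqrt (1 + (localTime G a j t : ℝ)) * (if a t ∈ nbhd G j then 1 else 0)
      ≤ 2 * Real.sqrt (localTime G a j T) := by
  induction T with
  | zero => simp
  | succ T ih =>
    rw [Finset.sum_range_succ, localTime_succ]
    split_ifs with h
    · set n : ℝ := (localTime G a j T : ℝ) with hn
      have hn0 : 0 ≤ n := Nat.cast_nonneg _
      have h1 : 0 < Real.sqrt (1 + n) := Real.sqrt_pos.2 (by linarith)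
      have h2 : Real.sqrt (1 + n) ^ 2 = 1 + n := Real.sq_sqrt (by linarith)
      have h3 : Real.sqrt n ^ 2 = n := Real.sq_sqrt hn0
      have h4 : 1 / Real.sqrt (1 + n) ≤ 2 * Real.sqrt (1 + n) - 2 * Real.sqrt n := by
        rw [div_le_iff₀ h1]
        nlinarith [sq_nonneg (Real.sqrt (1 + n) - Real.sqrt n)]
      have h5 : ((localTime G a j T + 1 : ℕ) : ℝ) = 1 + n := by push_cast; ring
      rw [h5]
      linarith
    · simpa using ih

/-- The linearized regret of the instance of MT-FTRL that agent `j` runs. -/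
noncomputable def localRegret (a : ℕ → Fin N) (g : ℕ → Vec d) (T : ℕ) (u : Vec d) (j : Fin N) :
    ℝ :=
  ∑ t ∈ Finset.range T, (roundLoss (fedTo G w a g j t) (localModel G w q a g j t)
    - roundLoss (fedTo G w a g j t) fun _ => u)

/-- Since the weights sum to `1`, `u` is the same weighted combination of copies of `u` as the
prediction is of local models. Agents outside the neighborhood are fed nothing and contribute `0`.
-/
theorem inner_prediction_sub (hw1 : ∀ i, ∑ j ∈ nbhd G i, w i j = 1) (a : ℕ → Fin N)
    (g : ℕ → Vec d) (u : Vec d) (t : ℕ) :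
    inner ℝ (g t) (prediction G w q a g t - u)
      = ∑ j, (roundLoss (fedTo G w a g j t) (localModel G w q a g j t)
        - roundLoss (fedTo G w a g j t) fun _ => u) := by
  have h0 : ∀ j ∉ nbhd G (a t), roundLoss (fedTo G w a g j t) (localModel G w q a g j t)
      - roundLoss (fedTo G w a g j t) (fun _ => u) = 0 := by
    intro j hj
    have : a t ∉ nbhd G j := fun h => hj (mem_nbhd_symm h)
    simp [fedTo, this, roundLoss]
  rw [← Finset.sum_subset (Finset.subset_univ (nbhd G (a t))) fun j _ hj => h0 j hj,
    ← Finset.sum_coe_sort]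
  have hu : u = ∑ j : {j // j ∈ nbhd G (a t)}, w (a t) j • u := by
    rw [← Finset.sum_smul, Finset.sum_coe_sort (nbhd G (a t)) (fun j => w (a t) j), hw1, one_smul]
  conv_lhs => rw [hu]
  rw [prediction, ← Finset.sum_sub_distrib, inner_sum]
  refine Finset.sum_congr rfl fun j _ => ?_
  have hj : a t ∈ nbhd G j := mem_nbhd_symm j.2
  simp [fedTo, hj, roundLoss, inner_smul_left, inner_smul_right, inner_sub_right]

theorem regret_const_le_sum_localRegret (hw1 : ∀ i, ∑ j ∈ nbhd G i, w i j = 1)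
    {ℓ : ℕ → Vec d → ℝ} {a : ℕ → Fin N} {g : ℕ → Vec d} {T : ℕ}
    (hg : ∀ t < T, IsSubgradientOn (decisionSet d) (ℓ t) (prediction G w q a g t) (g t))
    {u : Vec d} (hu : u ∈ decisionSet d) :
    regret G w q ℓ a g T (fun _ => u) ≤ ∑ j, localRegret G w q a g T u j := by
  simp only [localRegret]
  rw [Finset.sum_comm]
  refine Finset.sum_le_sum fun t ht => ?_
  rw [← inner_prediction_sub G w q hw1]
  have h := hg t (Finset.mem_range.1 ht) u hu
  rw [← neg_sub, inner_neg_right] at h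
  linarith

/-- The mean squared weight `∑_{i ∈ N_j} (q_i / Q_j) w_{ij}²`. -/
noncomputable def meanSqWeight (j : Fin N) : ℝ :=
  ∑ i ∈ nbhd G j, q i / nbhdProb G q j * w i j ^ 2

/-- A bound for the local regret of agent `j`. -/
noncomputable def localBound (a : ℕ → Fin N) (T : ℕ) (j : Fin N) : ℝ :=
  3 * (Real.sqrt (meanSqWeight G w q j) * Real.sqrt (localTime G a j T))
    + 4 / Real.sqrt (meanSqWeight G w q j) * ∑ t ∈ Finset.range T,
      1 / Real.sqrt (1 + (localTime G a j t : ℝ)) * (if a t ∈ nbhd G j then w (a t) j ^ 2 else 0)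

theorem localBound_nonneg (a : ℕ → Fin N) (T : ℕ) (j : Fin N) : 0 ≤ localBound G w q a T j := by
  refine add_nonneg (by positivity) (mul_nonneg (by positivity)
    (Finset.sum_nonneg fun t _ => mul_nonneg (by positivity) ?_))
  split_ifs
  · exact sq_nonneg _
  · exact le_rfl

theorem localRegret_le {a : ℕ → Fin N} {g : ℕ → Vec d} {T : ℕ} (hg : ∀ t < T, ‖g t‖ ≤ 1)
    {u : Vec d} (hu : u ∈ decisionSet d) (j : Fin N)
    (hv : 0 < meanSqWeight G w q j ∨ ∀ t < T, a t ∈ nbhd G j → w (a t) j = 0) :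
    localRegret G w q a g T u j ≤ Real.sqrt (1 + Real.log N) * localBound G w q a T j := by
  -- If the mean squared weight is `0`, then `β = 0` and the rates degenerate; in that case only
  -- zero vectors are fed, and the local regret vanishes.
  have hzero : (∀ t < T, a t ∈ nbhd G j → w (a t) j = 0) →
      localRegret G w q a g T u j ≤ Real.sqrt (1 + Real.log N) * localBound G w q a T j := by
    intro h
    refine le_of_eq_of_le ?_ (mul_nonneg (Real.sqrt_nonneg _) (localBound_nonneg G w q a T j))
    refine Finset.sum_eq_zero fun t ht => ?_
    by_cases hm : a t ∈ nbhd G j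
    · simp [fedTo, hm, roundLoss, h t (Finset.mem_range.1 ht) hm]
    · simp [fedTo, hm, roundLoss]
  rcases hv with hv | hv
  swap
  · exact hzero hv
  rcases Nat.eq_zero_or_pos (localTime G a j T) with hn | hn
  · refine hzero fun t ht hm => ?_
    rw [localTime, Finset.card_eq_zero] at hn
    have : t ∈ (Finset.range T).filter fun s => a s ∈ nbhd G j := by simp [ht, hm]
    rw [hn] at this
    exact absurd this (Finset.notMem_empty t)
  have : Nonempty {i // i ∈ nbhd G j} := ⟨⟨j, self_mem_nbhd G j⟩⟩
  have hsv : 0 < Real.sqrt (meanSqWeight G w q j) := Real.sqrt_pos.2 hv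
  have hβ : ∀ t, 0 < beta G w q a j t := fun t => mul_pos hsv (Real.sqrt_pos.2 (by positivity))
  have hmono : Monotone (beta G w q a j) := by
    intro s t hst
    refine mul_le_mul_of_nonneg_left (Real.sqrt_le_sqrt ?_) hsv.le
    have : (localTime G a j s : ℝ) ≤ localTime G a j t := by
      exact_mod_cast localTime_mono G a j hst
    linarith
  refine (mtFTRL_regret_const (fedTo G w a g j) hβ hmono T hu).trans ?_
  have hcard : Fintype.card {i // i ∈ nbhd G j} ≤ N := by
    simpa using Finset.card_le_univ (nbhd G j)
  have hS : Real.sqrt (1 + Real.log (Fintype.card {i // i ∈ nbhd G j}))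
      ≤ Real.sqrt (1 + Real.log N) := by
    refine Real.sqrt_le_sqrt (add_le_add_right (Real.log_le_log ?_ (by exact_mod_cast hcard)) 1)
    exact_mod_cast Fintype.card_pos
  refine mul_le_mul hS ?_ ?_ (Real.sqrt_nonneg _)
  · refine add_le_add ?_ ?_
    -- With at least one local round, `1 + n ≤ 2n ≤ (9/4) n`. Passing from `1 + n` to `n` avoids an
    -- additive term that does not scale with `√(Q_j T)`, and gives the constant `3 = 2 · 3/2`.
    · have h1 : Real.sqrt (1 + (localTime G a j T : ℝ))
          ≤ 3 / 2 * Real.sqrt (localTime G a j T) := by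
        have h2 : (1 : ℝ) ≤ localTime G a j T := by exact_mod_cast hn
        rw [Real.sqrt_le_left (by positivity), mul_pow, Real.sq_sqrt (by linarith)]
        linarith
      have h3 := mul_le_mul_of_nonneg_left h1 hsv.le
      have h4 : beta G w q a j T = Real.sqrt (meanSqWeight G w q j) *
        Real.sqrt (1 + (localTime G a j T : ℝ)) := rfl
      rw [h4]
      linarith
    · rw [div_mul_eq_mul_div, mul_div_assoc]
      refine mul_le_mul_of_nonneg_left ?_ (by norm_num)
      rw [Finset.sum_div]
      refine Finset.sum_le_sum fun t ht => ?_
      have hgt : ‖g t‖ ^ 2 ≤ 1 := pow_le_one₀ (norm_nonneg _) (hg t (Finset.mem_range.1 ht))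
      have h1 : roundSq (fedTo G w a g j t) ≤ if a t ∈ nbhd G j then w (a t) j ^ 2 else 0 := by
        split_ifs with hm
        · simp only [fedTo, hm, roundSq, dif_pos, Option.elim, norm_smul, mul_pow,
            Real.norm_eq_abs, sq_abs]
          exact mul_le_of_le_one_right (sq_nonneg _) hgt
        · simp [fedTo, hm, roundSq]
      refine (div_le_div_of_nonneg_right h1 (hβ t).le).trans_eq ?_
      have h4 : beta G w q a j t = Real.sqrt (meanSqWeight G w q j) *
        Real.sqrt (1 + (localTime G a j t : ℝ)) := rfl
      rw [h4, one_div_mul_eq_div, div_div, mul_comm (Real.sqrt (meanSqWeight G w q j))]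
  · have := Finset.sum_nonneg fun t (_ : t ∈ Finset.range T) =>
      div_nonneg (roundSq_nonneg (fedTo G w a g j t)) (hβ t).le
    have := hβ T
    positivity

end Pathwise

/-! ### The weights `w_{ij} = q_j / Q_i` and the independence number -/

section Independence

variable {N : ℕ} (G : SimpleGraph (Fin N)) {q : Fin N → ℝ}

/-- A weighted Caro–Wei bound. -/
theorem exists_isIndepSet_sum_div_le (hq : ∀ i, 0 ≤ q i) (S : Finset (Fin N)) :
    ∃ I ⊆ S, G.IsIndepSet (I : Set (Fin N)) ∧
      ∑ i ∈ S, q i / nbhdProb G q i ≤ (I.card : ℝ) := by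
  induction S using Finset.strongInduction with
  | H S ih =>
    rcases S.eq_empty_or_nonempty with rfl | hS
    · exact ⟨∅, subset_rfl, by simp, by simp⟩
    -- Greedy choice: take the vertex with the least `Q_i` and delete its closed neighborhood. The
    -- deleted terms have denominators at least `Q_i`, so together they amount to at most `Q_i / Q_i
    -- ≤ 1`.
    obtain ⟨i, hi, hmin⟩ := S.exists_min_image (nbhdProb G q) hS
    obtain ⟨I, hIS, hI, hsum⟩ := ih (S \ nbhd G i) (by
      refine Finset.ssubset_iff_subset_ne.2 ⟨Finset.sdiff_subset, fun h => ?_⟩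
      rw [← h] at hi
      exact (Finset.mem_sdiff.1 hi).2 (self_mem_nbhd G i))
    have hiI : i ∉ I := fun h => (Finset.mem_sdiff.1 (hIS h)).2 (self_mem_nbhd G i)
    refine ⟨insert i I, Finset.insert_subset hi (hIS.trans Finset.sdiff_subset), ?_, ?_⟩
    · have hadj : ∀ k ∈ I, ¬ G.Adj i k := by
        intro k hk hik
        exact (Finset.mem_sdiff.1 (hIS hk)).2 (by simp [nbhd, hik])
      rw [Finset.coe_insert]
      intro k hk m hm hkm
      rcases hk with rfl | hk <;> rcases hm with rfl | hm
      · exact absurd rfl hkm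
      · exact hadj m hm
      · exact fun h => hadj k hk h.symm
      · exact hI hk hm hkm
    · rw [Finset.card_insert_of_notMem hiI, ← Finset.sum_sdiff (Finset.inter_subset_left :
        S ∩ nbhd G i ⊆ S), Finset.sdiff_inter_self_left]
      push_cast
      refine add_le_add hsum ?_
      have hQ : 0 ≤ nbhdProb G q i := Finset.sum_nonneg fun k _ => hq k
      have hle : ∀ k ∈ S ∩ nbhd G i, q k / nbhdProb G q k ≤ q k / nbhdProb G q i := by
        intro k hk
        have hk' := Finset.mem_inter.1 hk
        have hkQ : q k ≤ nbhdProb G q i :=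
          Finset.single_le_sum (f := q) (fun m _ => hq m) hk'.2
        rcases hQ.eq_or_lt with h0 | hpos
        · rw [le_antisymm (hkQ.trans h0.ge) (hq k)]
          simp
        · exact div_le_div_of_nonneg_left (hq k) hpos (hmin k hk'.1)
      calc ∑ k ∈ S ∩ nbhd G i, q k / nbhdProb G q k
          ≤ ∑ k ∈ S ∩ nbhd G i, q k / nbhdProb G q i := Finset.sum_le_sum hle
        _ ≤ ∑ k ∈ nbhd G i, q k / nbhdProb G q i :=
            Finset.sum_le_sum_of_subset_of_nonneg Finset.inter_subset_right
              fun k _ _ => div_nonneg (hq k) hQ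
        _ = nbhdProb G q i / nbhdProb G q i := by rw [← Finset.sum_div, nbhdProb]
        _ ≤ 1 := div_self_le_one _

theorem sum_div_nbhdProb_le_indepNum (hq : ∀ i, 0 ≤ q i) :
    ∑ i, q i / nbhdProb G q i ≤ (G.indepNum : ℝ) := by
  obtain ⟨I, -, hI, hsum⟩ := exists_isIndepSet_sum_div_le G hq Finset.univ
  exact hsum.trans (by exact_mod_cast hI.card_le_indepNum)

/-- Each summand is `√q_j · √(q_j r_j)` with `r_j = ∑ q_i / Q_i²` over the neighborhood of `j`.
Cauchy–Schwarz applies, and exchanging the sums turns `∑ q_j r_j` into the Caro–Wei sum `∑ q_i /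
Q_i`. -/
theorem sum_sqrt_le_sqrt_indepNum (hq : ∀ i, 0 ≤ q i) (hq1 : ∑ i, q i = 1)
    {w : Fin N → Fin N → ℝ}
    (hw : ∀ i, nbhdProb G q i ≠ 0 → ∀ j ∈ nbhd G i, w i j = q j / nbhdProb G q i) :
    ∑ j, Real.sqrt (∑ i ∈ nbhd G j, q i * w i j ^ 2) ≤ Real.sqrt G.indepNum := by
  set r : Fin N → ℝ := fun j => ∑ i ∈ nbhd G j, q i / nbhdProb G q i ^ 2 with hr
  have hr0 : ∀ j, 0 ≤ r j := fun j =>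
    Finset.sum_nonneg fun i _ => div_nonneg (hq i) (sq_nonneg _)
  have h1 : ∀ j, ∑ i ∈ nbhd G j, q i * w i j ^ 2 = q j ^ 2 * r j := by
    intro j
    rw [hr, Finset.mul_sum]
    refine Finset.sum_congr rfl fun i hi => ?_
    -- The formula for the weights is not available when `Q_i = 0`, but then `q_i = 0` as well.
    by_cases h0 : nbhdProb G q i = 0
    · have hle : q i ≤ nbhdProb G q i :=
        Finset.single_le_sum (f := q) (fun m _ => hq m) (self_mem_nbhd G i)
      have : q i = 0 := le_antisymm (h0 ▸ hle) (hq i)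
      simp [this]
    · rw [hw i h0 j (mem_nbhd_symm hi), div_pow]
      ring
  have h2 : ∀ j, Real.sqrt (∑ i ∈ nbhd G j, q i * w i j ^ 2)
      = Real.sqrt (q j) * Real.sqrt (q j * r j) := by
    intro j
    rw [h1, ← Real.sqrt_mul (hq j)]
    congr 1
    ring
  have h3 : ∑ j, q j * r j ≤ (G.indepNum : ℝ) := by
    refine le_of_eq_of_le ?_ (sum_div_nbhdProb_le_indepNum G hq)
    have h4 : ∀ j, q j * r j
        = ∑ i, if j ∈ nbhd G i then q j * (q i / nbhdProb G q i ^ 2) else 0 := by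
      intro j
      rw [hr, Finset.mul_sum, ← Finset.sum_filter]
      refine Finset.sum_congr ?_ fun _ _ => rfl
      ext i
      simp only [Finset.mem_filter, Finset.mem_univ, true_and]
      exact ⟨mem_nbhd_symm, mem_nbhd_symm⟩
    simp_rw [h4]
    rw [Finset.sum_comm]
    refine Finset.sum_congr rfl fun i _ => ?_
    rw [Finset.sum_ite_mem, Finset.univ_inter, ← Finset.sum_mul]
    change nbhdProb G q i * (q i / nbhdProb G q i ^ 2) = _
    by_cases h0 : nbhdProb G q i = 0
    · simp [h0]
    · field_simp
  simp_rw [h2]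
  refine Real.le_sqrt_of_sq_le ((Finset.sum_mul_sq_le_sq_mul_sq _ _ _).trans ?_)
  rw [Finset.sum_congr rfl fun j _ => Real.sq_sqrt (hq j), hq1, one_mul,
    Finset.sum_congr rfl fun j _ => Real.sq_sqrt (mul_nonneg (hq j) (hr0 j))]
  exact h3

end Independence

/-! ### Independent activations -/

section Probability

open MeasureTheory ProbabilityTheory

variable {N T : ℕ} {Ω : Type*} [MeasurableSpace Ω] {P : Measure Ω} [IsProbabilityMeasure P]
  {act : ℕ → Ω → Fin N} {q : Fin N → ℝ}

/-- The function factors through the finite space of the first `T` activations, on which every real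
function is integrable. -/
theorem integrable_of_dependsOn (hmeas : ∀ t < T, Measurable (act t)) {f : (ℕ → Fin N) → ℝ}
    (hf : DependsOn f (Set.Iio T)) : Integrable (fun ω => f fun t => act t ω) P := by
  obtain ⟨h, rfl⟩ := dependsOn_iff_exists_comp.1 hf
  have hA : Measurable fun ω => fun s : Set.Iio T => act s ω :=
    measurable_pi_lambda _ fun s => hmeas s s.2
  have : IsFiniteMeasure (P.map fun ω => fun s : Set.Iio T => act s ω) := inferInstance
  exact (Integrable.of_finite (μ := P.map fun ω => fun s : Set.Iio T => act s ω)
    (f := h)).comp_measurable hA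

theorem integral_comp_act {t : ℕ} (hmeas : Measurable (act t))
    (hlaw : ∀ i, P.real {ω | act t ω = i} = q i) (h : Fin N → ℝ) :
    ∫ ω, h (act t ω) ∂P = ∑ i, q i * h i := by
  have : IsProbabilityMeasure (P.map (act t)) :=
    Measure.isProbabilityMeasure_map hmeas.aemeasurable
  rw [← integral_map (f := h) hmeas.aemeasurable (measurable_of_finite h).aestronglyMeasurable,
    integral_fintype Integrable.of_finite]
  refine Finset.sum_congr rfl fun i _ => ?_
  rw [map_measureReal_apply hmeas (measurableSet_singleton i), ← hlaw i]
  rfl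

/-- The activation of round `t` is independent of the earlier activations. -/
theorem integral_mul_act (hmeas : ∀ t < T, Measurable (act t))
    (hind : iIndepFun (fun t : Fin T => act t) P)
    (hlaw : ∀ t < T, ∀ i, P.real {ω | act t ω = i} = q i) {t : ℕ} (ht : t < T)
    {f : (ℕ → Fin N) → ℝ} (hf : DependsOn f (Set.Iio t)) (h : Fin N → ℝ) :
    ∫ ω, f (fun s => act s ω) * h (act t ω) ∂P
      = (∫ ω, f (fun s => act s ω) ∂P) * ∑ i, q i * h i := by
  obtain ⟨F, rfl⟩ := dependsOn_iff_exists_comp.1 hf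
  rw [← integral_comp_act (hmeas t ht) (hlaw t ht)]
  let S : Finset (Fin T) := Finset.univ.filter fun s => (s : ℕ) < t
  have hS : ∀ s : Set.Iio t, (⟨s, s.2.trans ht⟩ : Fin T) ∈ S := fun s =>
    Finset.mem_filter.2 ⟨Finset.mem_univ _, s.2⟩
  have hdisj : Disjoint S {⟨t, ht⟩} := by simp [S]
  have h0 := hind.indepFun_finset S {⟨t, ht⟩} hdisj fun s => hmeas s s.2
  have h1 := h0.comp
    (φ := fun p : S → Fin N => F fun s : Set.Iio t => p ⟨⟨s, s.2.trans ht⟩, hS s⟩)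
    (ψ := fun p : ({⟨t, ht⟩} : Finset (Fin T)) → Fin N =>
      h (p ⟨⟨t, ht⟩, Finset.mem_singleton_self _⟩))
    (measurable_of_finite _) (measurable_of_finite _)
  refine h1.integral_fun_mul_eq_mul_integral ?_ ?_
  · exact ((measurable_of_finite _).comp (measurable_pi_lambda _
      fun s : S => hmeas s.1 s.1.2)).aestronglyMeasurable
  · exact ((measurable_of_finite h).comp (hmeas t ht)).aestronglyMeasurable

/-- A vanishing mean squared weight forces `w i j = 0` only where `q i ≠ 0`; the other agents are
almost surely never active. -/
theorem ae_act_ne {t : ℕ} (hlaw : ∀ i, P.real {ω | act t ω = i} = q i) :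
    ∀ᵐ ω ∂P, q (act t ω) ≠ 0 := by
  have h : ∀ i, q i = 0 → ∀ᵐ ω ∂P, act t ω ≠ i := by
    intro i hi
    have h1 := hlaw i
    rw [hi, measureReal_eq_zero_iff] at h1
    simpa [ae_iff] using h1
  have h2 : ∀ᵐ ω ∂P, ∀ i, q i = 0 → act t ω ≠ i :=
    ae_all_iff.2 fun i => by
      by_cases hi : q i = 0
      · filter_upwards [h i hi] with ω hω _ using hω
      · exact Filter.Eventually.of_forall fun ω h0 => absurd h0 hi
  filter_upwards [h2] with ω hω h0 using hω _ h0 rfl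

end Probability

/-! ### The expected regret -/

section Expectation

open MeasureTheory ProbabilityTheory

variable {N d T : ℕ} (G : SimpleGraph (Fin N)) {w : Fin N → Fin N → ℝ} {q : Fin N → ℝ}
  {Ω : Type*} [MeasurableSpace Ω] {P : Measure Ω} [IsProbabilityMeasure P] {act : ℕ → Ω → Fin N}

theorem dependsOn_localTime (j : Fin N) (t : ℕ) (f : ℕ → ℝ) :
    DependsOn (fun a => f (localTime G a j t)) (Set.Iio t) :=
  fun _ _ h => congrArg f (localTime_congr G h j)

theorem DependsOn.mul_act {t : ℕ} (ht : t < T) {f : (ℕ → Fin N) → ℝ}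
    (hf : DependsOn f (Set.Iio t)) (h : Fin N → ℝ) :
    DependsOn (fun a : ℕ → Fin N => f a * h (a t)) (Set.Iio T) := by
  intro a a' haa
  simp only
  rw [haa t ht, hf fun s hs => haa s (hs.trans ht)]

theorem meanSqWeight_nonneg (hq : ∀ i, 0 ≤ q i) (j : Fin N) : 0 ≤ meanSqWeight G w q j :=
  Finset.sum_nonneg fun i _ =>
    mul_nonneg (div_nonneg (hq i) (Finset.sum_nonneg fun k _ => hq k)) (sq_nonneg _)

theorem meanSqWeight_mul_nbhdProb (hq : ∀ i, 0 ≤ q i) (j : Fin N) :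
    meanSqWeight G w q j * nbhdProb G q j = ∑ i ∈ nbhd G j, q i * w i j ^ 2 := by
  rw [meanSqWeight, Finset.sum_mul]
  refine Finset.sum_congr rfl fun i hi => ?_
  by_cases h0 : nbhdProb G q j = 0
  · have hle : q i ≤ nbhdProb G q j := Finset.single_le_sum (f := q) (fun m _ => hq m) hi
    have : q i = 0 := le_antisymm (h0 ▸ hle) (hq i)
    simp [this]
  · field_simp

theorem integrable_localBound (hmeas : ∀ t < T, Measurable (act t)) (j : Fin N) :
    Integrable (fun ω => localBound G w q (fun t => act t ω) T j) P := by
  refine integrable_of_dependsOn (f := fun a => localBound G w q a T j) hmeas fun a a' h => ?_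
  simp only [localBound]
  rw [localTime_congr G h j]
  congr 2
  refine Finset.sum_congr rfl fun t ht => ?_
  have ht := Finset.mem_range.1 ht
  rw [h t ht, localTime_congr G (fun s hs => h s (hs.trans ht)) j]

theorem integral_sqrt_localTime_le (hmeas : ∀ t < T, Measurable (act t))
    (hlaw : ∀ t < T, ∀ i, P.real {ω | act t ω = i} = q i) (j : Fin N) :
    ∫ ω, Real.sqrt (localTime G (fun t => act t ω) j T) ∂P ≤ Real.sqrt (nbhdProb G q j * T) := by
  have hint : Integrable (fun ω => (localTime G (fun t => act t ω) j T : ℝ)) P :=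
    integrable_of_dependsOn hmeas (dependsOn_localTime G j T fun n => (n : ℝ))
  have h1 : ∫ ω, (localTime G (fun t => act t ω) j T : ℝ) ∂P = nbhdProb G q j * T := by
    simp only [localTime_eq_sum]
    rw [integral_finsetSum]
    · rw [Finset.sum_congr rfl fun t ht => integral_comp_act (hmeas t (Finset.mem_range.1 ht))
        (hlaw t (Finset.mem_range.1 ht)) fun i => if i ∈ nbhd G j then (1 : ℝ) else 0]
      simp [nbhdProb, mul_comm]
    · intro t ht
      exact integrable_of_dependsOn (f := fun a => if a t ∈ nbhd G j then (1 : ℝ) else 0) hmeas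
        fun a a' h => by simp only [h t (Finset.mem_range.1 ht)]
  rw [← h1]
  exact Real.strictConcaveOn_sqrt.concaveOn.le_map_integral Real.continuous_sqrt.continuousOn
    isClosed_Ici (Filter.Eventually.of_forall fun ω => Set.mem_Ici.2 (Nat.cast_nonneg _)) hint
    (integrable_of_dependsOn hmeas (dependsOn_localTime G j T fun n => Real.sqrt n))

/-- By independence, the sums of `1 / √(1 + n_j)` against the indicator of the neighborhood and
against the squared weights factor through the same `∑ D t`, with means `Q` and `v Q`. The pathwise
telescoping bound on the first therefore controls the second. The constant is `11 = 3 + 4 · 2`. -/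
theorem integral_localBound_le (hq : ∀ i, 0 ≤ q i) (hmeas : ∀ t < T, Measurable (act t))
    (hind : iIndepFun (fun t : Fin T => act t) P)
    (hlaw : ∀ t < T, ∀ i, P.real {ω | act t ω = i} = q i) (j : Fin N) :
    ∫ ω, localBound G w q (fun t => act t ω) T j ∂P
      ≤ 11 * (Real.sqrt (∑ i ∈ nbhd G j, q i * w i j ^ 2) * Real.sqrt T) := by
  set v := meanSqWeight G w q j with hv
  have hv0 : 0 ≤ v := meanSqWeight_nonneg G hq j
  set Q := nbhdProb G q j with hQ
  have hdep : ∀ t, DependsOn (fun a : ℕ → Fin N => 1 / Real.sqrt (1 + (localTime G a j t : ℝ)))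
      (Set.Iio t) := fun t => dependsOn_localTime G j t fun n => 1 / Real.sqrt (1 + (n : ℝ))
  set D : ℕ → ℝ := fun t =>
    ∫ ω, 1 / Real.sqrt (1 + (localTime G (fun s => act s ω) j t : ℝ)) ∂P with hD
  have hsum : ∀ h : Fin N → ℝ, Integrable (fun ω => ∑ t ∈ Finset.range T,
        1 / Real.sqrt (1 + (localTime G (fun s => act s ω) j t : ℝ)) * h (act t ω)) P ∧
      ∫ ω, ∑ t ∈ Finset.range T,
        1 / Real.sqrt (1 + (localTime G (fun s => act s ω) j t : ℝ)) * h (act t ω) ∂P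
      = (∑ t ∈ Finset.range T, D t) * ∑ i, q i * h i := by
    intro h
    have hint : ∀ t ∈ Finset.range T, Integrable (fun ω =>
        1 / Real.sqrt (1 + (localTime G (fun s => act s ω) j t : ℝ)) * h (act t ω)) P :=
      fun t ht => integrable_of_dependsOn hmeas
        (DependsOn.mul_act (Finset.mem_range.1 ht) (hdep t) h)
    refine ⟨integrable_finsetSum _ hint, ?_⟩
    rw [integral_finsetSum _ hint, Finset.sum_mul]
    exact Finset.sum_congr rfl fun t ht =>
      integral_mul_act hmeas hind hlaw (Finset.mem_range.1 ht) (hdep t) h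
  have hsqrt := integral_sqrt_localTime_le G hmeas hlaw j
  have hintsqrt : Integrable (fun ω => Real.sqrt (localTime G (fun t => act t ω) j T)) P :=
    integrable_of_dependsOn hmeas (dependsOn_localTime G j T fun n => Real.sqrt n)
  obtain ⟨hone, hone'⟩ := hsum fun i => if i ∈ nbhd G j then 1 else 0
  obtain ⟨hsq, hsq'⟩ := hsum fun i => if i ∈ nbhd G j then w i j ^ 2 else 0
  have hDQ : (∑ t ∈ Finset.range T, D t) * Q ≤ 2 * Real.sqrt (Q * T) := by
    have h1 := integral_mono hone (hintsqrt.const_mul 2) fun ω =>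
      sum_inv_sqrt_localTime_le G (fun t => act t ω) j T
    rw [hone', integral_const_mul] at h1
    have h2 : ∑ i, q i * (if i ∈ nbhd G j then (1 : ℝ) else 0) = Q := by simp [hQ, nbhdProb]
    rw [h2] at h1
    linarith
  have hvQ : ∑ i, q i * (if i ∈ nbhd G j then w i j ^ 2 else 0) = v * Q := by
    rw [hv, hQ, meanSqWeight_mul_nbhdProb G hq]
    simp
  rw [hvQ] at hsq'
  have hmain : ∫ ω, localBound G w q (fun t => act t ω) T j ∂P
      = 3 * (Real.sqrt v * ∫ ω, Real.sqrt (localTime G (fun t => act t ω) j T) ∂P)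
        + 4 / Real.sqrt v * ((∑ t ∈ Finset.range T, D t) * (v * Q)) := by
    rw [← hsq', ← integral_const_mul, ← integral_const_mul, ← integral_const_mul]
    exact integral_add ((hintsqrt.const_mul _).const_mul _) (hsq.const_mul _)
  have hdiv : 4 / Real.sqrt v * ((∑ t ∈ Finset.range T, D t) * (v * Q))
      = 4 * (Real.sqrt v * ((∑ t ∈ Finset.range T, D t) * Q)) := by
    have h : v / Real.sqrt v = Real.sqrt v := Real.div_sqrt
    calc _ = 4 * (v / Real.sqrt v * ((∑ t ∈ Finset.range T, D t) * Q)) := by ring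
      _ = _ := by rw [h]
  have hfin : Real.sqrt v * Real.sqrt (Q * T)
      = Real.sqrt (∑ i ∈ nbhd G j, q i * w i j ^ 2) * Real.sqrt T := by
    have hQ0 : 0 ≤ Q := Finset.sum_nonneg fun k _ => hq k
    rw [← meanSqWeight_mul_nbhdProb G hq, ← hv, ← hQ, Real.sqrt_mul hQ0, Real.sqrt_mul hv0,
      mul_assoc]
  rw [hmain, hdiv, ← hfin]
  have h1 := mul_le_mul_of_nonneg_left hsqrt (Real.sqrt_nonneg v)
  have h2 := mul_le_mul_of_nonneg_left hDQ (Real.sqrt_nonneg v)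
  linarith

/-- As the losses are fixed in advance and the activations are identically distributed, some single
row of `U`, used by all agents, is in expectation as good a comparator as `U`. This also covers the
comparators whose local variances exceed the largest grid point `1`. -/
theorem exists_integral_regret_le_const (hq : ∀ i, 0 ≤ q i) (hq1 : ∑ i, q i = 1)
    (hmeas : ∀ t < T, Measurable (act t))
    (hlaw : ∀ t < T, ∀ i, P.real {ω | act t ω = i} = q i)
    {ℓ : ℕ → Vec d → ℝ} (U : Fin N → Vec d) {g : (ℕ → Fin N) → ℕ → Vec d}
    (hg : ∀ a a' : ℕ → Fin N, ∀ t, (∀ s ≤ t, a s = a' s) → g a t = g a' t) :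
    ∃ k, ∫ ω, regret G w q ℓ (fun t => act t ω) (g fun t => act t ω) T U ∂P
      ≤ ∫ ω, regret G w q ℓ (fun t => act t ω) (g fun t => act t ω) T (fun _ => U k) ∂P := by
  have hne : (Finset.univ : Finset (Fin N)).Nonempty := by
    rw [Finset.nonempty_iff_ne_empty]
    intro h
    rw [h] at hq1
    simp at hq1
  -- The best single row for the whole loss sequence. It does not depend on the activations, because
  -- the losses do not.
  obtain ⟨k, -, hk⟩ := Finset.univ.exists_min_image
    (fun i => ∑ t ∈ Finset.range T, ℓ t (U i)) hne
  refine ⟨k, ?_⟩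
  have hint : ∀ V : Fin N → Vec d, Integrable (fun ω =>
      regret G w q ℓ (fun t => act t ω) (g fun t => act t ω) T V) P := fun V =>
    integrable_of_dependsOn hmeas (dependsOn_regret G w q ℓ V hg T)
  rw [← sub_nonneg, ← integral_sub (hint _) (hint _)]
  -- The predictions do not involve the comparator, so they cancel.
  have hdiff : ∀ ω, regret G w q ℓ (fun t => act t ω) (g fun t => act t ω) T (fun _ => U k)
      - regret G w q ℓ (fun t => act t ω) (g fun t => act t ω) T U
      = ∑ t ∈ Finset.range T, (ℓ t (U (act t ω)) - ℓ t (U k)) := by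
    intro ω
    rw [regret, regret, ← Finset.sum_sub_distrib]
    exact Finset.sum_congr rfl fun t _ => by ring
  simp_rw [hdiff]
  rw [integral_finsetSum]
  · rw [Finset.sum_congr rfl fun t ht => integral_comp_act (hmeas t (Finset.mem_range.1 ht))
      (hlaw t (Finset.mem_range.1 ht)) fun i => ℓ t (U i) - ℓ t (U k), Finset.sum_comm]
    refine Finset.sum_nonneg fun i _ => ?_
    rw [← Finset.mul_sum, Finset.sum_sub_distrib]
    exact mul_nonneg (hq i) (sub_nonneg.2 (hk i (Finset.mem_univ i)))
  · intro t ht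
    exact integrable_of_dependsOn (f := fun a => ℓ t (U (a t)) - ℓ t (U k)) hmeas
      fun a a' h => by simp only [h t (Finset.mem_range.1 ht)]

/-- The expected regret of MT-COOL. -/
theorem integral_regret_le (hq : ∀ i, 0 ≤ q i) (hq1 : ∑ i, q i = 1)
    (hw1 : ∀ i, ∑ j ∈ nbhd G i, w i j = 1) {ℓ : ℕ → Vec d → ℝ} {U : Fin N → Vec d}
    (hU : ∀ i, U i ∈ decisionSet d) {g : (ℕ → Fin N) → ℕ → Vec d}
    (hg : ∀ a a' : ℕ → Fin N, ∀ t, (∀ s ≤ t, a s = a' s) → g a t = g a' t)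
    (hsub : ∀ a : ℕ → Fin N, ∀ t < T,
      IsSubgradientOn (decisionSet d) (ℓ t) (prediction G w q a (g a) t) (g a t) ∧ ‖g a t‖ ≤ 1)
    (hmeas : ∀ t < T, Measurable (act t)) (hind : iIndepFun (fun t : Fin T => act t) P)
    (hlaw : ∀ t < T, ∀ i, P.real {ω | act t ω = i} = q i) :
    ∫ ω, regret G w q ℓ (fun t => act t ω) (g fun t => act t ω) T U ∂P
      ≤ 11 * Real.sqrt (1 + Real.log N)
        * (∑ j, Real.sqrt (∑ i ∈ nbhd G j, q i * w i j ^ 2)) * Real.sqrt T := by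
  obtain ⟨k, hk⟩ := exists_integral_regret_le_const (w := w) (ℓ := ℓ) G hq hq1 hmeas hlaw U hg
  refine hk.trans ?_
  have hpos : ∀ᵐ ω ∂P, ∀ t < T, q (act t ω) ≠ 0 := by
    refine ae_all_iff.2 fun t => ?_
    by_cases ht : t < T
    · filter_upwards [ae_act_ne (hlaw t ht)] with ω hω _ using hω
    · exact Filter.Eventually.of_forall fun ω h => absurd h ht
  have hbound : ∀ᵐ ω ∂P,
      regret G w q ℓ (fun t => act t ω) (g fun t => act t ω) T (fun _ => U k)
      ≤ ∑ j, Real.sqrt (1 + Real.log N) * localBound G w q (fun t => act t ω) T j := by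
    filter_upwards [hpos] with ω hω
    refine (regret_const_le_sum_localRegret G w q hw1 (fun t ht => (hsub _ t ht).1)
      (hU k)).trans (Finset.sum_le_sum fun j _ => ?_)
    refine localRegret_le G w q (fun t ht => (hsub _ t ht).2) (hU k) j ?_
    rcases (meanSqWeight_nonneg G (w := w) hq j).eq_or_lt with h0 | h0
    · refine Or.inr fun t ht hm => ?_
      have h1 := meanSqWeight_mul_nbhdProb G (w := w) hq j
      rw [← h0, zero_mul, eq_comm, Finset.sum_eq_zero_iff_of_nonneg
        fun i _ => mul_nonneg (hq i) (sq_nonneg _)] at h1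
      simpa [hω t ht] using h1 _ hm
    · exact Or.inl h0
  have hintB : ∀ j ∈ (Finset.univ : Finset (Fin N)), Integrable (fun ω =>
      Real.sqrt (1 + Real.log N) * localBound G w q (fun t => act t ω) T j) P :=
    fun j _ => (integrable_localBound G hmeas j).const_mul _
  refine (integral_mono_ae (integrable_of_dependsOn hmeas (dependsOn_regret G w q ℓ _ hg T))
    (integrable_finsetSum _ hintB) hbound).trans ?_
  rw [integral_finsetSum _ hintB, Finset.mul_sum, Finset.sum_mul]
  refine Finset.sum_le_sum fun j _ => ?_
  rw [integral_const_mul]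
  refine (mul_le_mul_of_nonneg_left (integral_localBound_le G hq hmeas hind hlaw j)
    (Real.sqrt_nonneg _)).trans_eq ?_
  ring

end Expectation

/-! ### The variance factors are at least one -/

section Variance

variable {N d : ℕ} (G : SimpleGraph (Fin N)) (U : Fin N → Vec d)

theorem one_le_card_nbhd (j : Fin N) : (1 : ℝ) ≤ (nbhd G j).card := by
  exact_mod_cast Finset.card_pos.2 ⟨j, self_mem_nbhd G j⟩

theorem localVariance_nonneg (j : Fin N) : 0 ≤ localVariance G U j := by
  have h := one_le_card_nbhd G j
  exact mul_nonneg (one_div_nonneg.2 (mul_nonneg (by linarith) (by linarith)))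
    (Finset.sum_nonneg fun _ _ => Finset.sum_nonneg fun _ _ => sq_nonneg _)

theorem one_le_sqrt_localVariance (j : Fin N) :
    1 ≤ Real.sqrt (1 + localVariance G U j * (((nbhd G j).card : ℝ) - 1)) := by
  have := mul_nonneg (localVariance_nonneg G U j) (sub_nonneg.2 (one_le_card_nbhd G j))
  rw [Real.one_le_sqrt]
  linarith

theorem one_le_sqrt_maxVariance [Nonempty (Fin N)] :
    1 ≤ Real.sqrt (1 + maxVariance G U * ((maxNbhd G : ℝ) - 1)) := by
  obtain ⟨j⟩ := ‹Nonempty (Fin N)›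
  have h1 : (nbhd G j).card ≤ maxNbhd G :=
    Finset.le_sup (f := fun j => (nbhd G j).card) (Finset.mem_univ j)
  have h2 : (1 : ℝ) ≤ maxNbhd G := (one_le_card_nbhd G j).trans (by exact_mod_cast h1)
  have := mul_nonneg (Real.iSup_nonneg fun j => localVariance_nonneg G U j) (sub_nonneg.2 h2)
  rw [Real.one_le_sqrt, maxVariance]
  linarith

end Variance

end MTCool

theorem mainTheorem2 :
    ∃ C : ℝ, 0 < C ∧
      ∀ (N d T : ℕ) (G : SimpleGraph (Fin N)) (q : Fin N → ℝ) (w : Fin N → Fin N → ℝ)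
        (ℓ : ℕ → Vec d → ℝ) (U : Fin N → Vec d)
        -- the observed subgradients, as a function of the sequence of activations
        (g : (ℕ → Fin N) → ℕ → Vec d)
        (Ω : Type*) [MeasurableSpace Ω] (P : MeasureTheory.Measure Ω)
        [MeasureTheory.IsProbabilityMeasure P] (act : ℕ → Ω → Fin N),
        -- the activation probabilities
        (∀ i, 0 ≤ q i) → ∑ i, q i = 1 →
        -- the weights
        (∀ i, ∀ j ∈ nbhd G i, 0 ≤ w i j) → (∀ i, ∑ j ∈ nbhd G i, w i j = 1) →
        -- the losses and the comparator
        (∀ t, ConvexOn ℝ (decisionSet d) (ℓ t)) → (∀ i, U i ∈ decisionSet d) →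
        -- the subgradient observed in round `t` depends on the activations up to round `t`
        (∀ a a' : ℕ → Fin N, ∀ t, (∀ s ≤ t, a s = a' s) → g a t = g a' t) →
        (∀ a : ℕ → Fin N, ∀ t < T,
          IsSubgradientOn (decisionSet d) (ℓ t) (prediction G w q a (g a) t) (g a t) ∧
            ‖g a t‖ ≤ 1) →
        -- independent activations with law `q`
        (∀ t < T, Measurable (act t)) →
        ProbabilityTheory.iIndepFun (fun t : Fin T => act t) P →
        (∀ t < T, ∀ i, P.real {ω | act t ω = i} = q i) →
        MeasureTheory.Integrable
            (fun ω => regret G w q ℓ (fun t => act t ω) (g fun t => act t ω) T U) P ∧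
          ∫ ω, regret G w q ℓ (fun t => act t ω) (g fun t => act t ω) T U ∂P ≤
            C * Real.sqrt (1 + Real.log N) *
              (∑ j, Real.sqrt (∑ i ∈ nbhd G j, q i * w i j ^ 2) *
                Real.sqrt (1 + localVariance G U j * (((nbhd G j).card : ℝ) - 1))) *
              Real.sqrt T ∧
          ((∀ i, nbhdProb G q i ≠ 0 → ∀ j ∈ nbhd G i, w i j = q j / nbhdProb G q i) →
            ∫ ω, regret G w q ℓ (fun t => act t ω) (g fun t => act t ω) T U ∂P ≤
              C * Real.sqrt (1 + Real.log N) *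
                Real.sqrt (1 + maxVariance G U * ((maxNbhd G : ℝ) - 1)) *
                Real.sqrt ((G.indepNum : ℝ) * T)) := by
  refine ⟨11, by norm_num, ?_⟩
  intro N d T G q w ℓ U g Ω _ P _ act hq hq1 _ hw1 _ hU hg hsub hmeas hind hlaw
  have hmain := integral_regret_le G hq hq1 hw1 hU hg hsub hmeas hind hlaw
  refine ⟨integrable_of_dependsOn hmeas (dependsOn_regret G w q ℓ U hg T), hmain.trans ?_,
    fun hw => hmain.trans ?_⟩
  -- The bound already holds without variance factors; each of them is at least `1`, so inserting
  -- them only weakens it.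
  · gcongr with j
    exact le_mul_of_one_le_right (Real.sqrt_nonneg _) (one_le_sqrt_localVariance G U j)
  · have : Nonempty (Fin N) := by
      by_contra h
      rw [not_nonempty_iff] at h
      simp at hq1
    have hα := sum_sqrt_le_sqrt_indepNum G hq hq1 hw
    have hσ := le_mul_of_one_le_left (Real.sqrt_nonneg (G.indepNum : ℝ))
      (one_le_sqrt_maxVariance G U)
    refine (mul_le_mul_of_nonneg_right (mul_le_mul_of_nonneg_left (hα.trans hσ) ?_) ?_).trans_eq ?_
    · positivity
    · positivity
    · rw [Real.sqrt_mul (Nat.cast_nonneg _)]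
      ring
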